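/- Let $t\ge 1$ be an integer. (Weighted sums.) Let $X_1,\dots,X_t$ be i.i.d. exponential random variables with rate $1$, put $\theta(t)=\{q\in\mathbb R^t : q_i\ge 0 \text{ for all } i,\ \sum_i q_i\le 1\}$, and for $x>0$ let $A(x)$ be the set of minimizers over $q\in\theta(t)$ of $\mathbb P\{\sum_i q_iX_i\le x\}$. (MISO outage.) Let $H=(H_1,\dots,H_t)$ be a random row vector whose entries are i.i.d. circularly symmetric complex Gaussian with $\mathbb E|H_i|^2=1$ (independent real and imaginary parts, each $\mathcal N(0,1/2)$), put $\xi(t)=\{Q\in\mathbb C^{t\times t} : Q \text{ Hermitian positive semidefinite},\ \operatorname{tr}Q\le 1\}$, and for $x>0$ let $B(x)$ be the set of minimizers over $Q\in\xi(t)$ of $\mathbb P\{HQH^*\le x\}$. For $k\in\{1,\dots,t\}$ let $u_k=(1/k,\dots,1/k,0,\dots,0)\in\mathbb R^t$ with $k$ entries $1/k$, let $O_k$ be the set of all permutations of $u_k$, and let $\mathcal O_k=\{U\operatorname{diag}(u_k)U^* : U \text{ a } t\times t \text{ unitary matrix}\}$. Then: (1) For every $x>0$ there is a nonempty set $K\subseteq\{1,\dots,t\}$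 such that $$A(x)=\bigcup_{k\in K}O_k \quad\text{and}\quad B(x)=\bigcup_{k\in K}\mathcal O_k .$$ That is, the minimizers exist, every minimizer has the stated form, and the values of $k$ that occur are the same in the two problems. (2) For all $x>0$ outside a finite set, there is a single $k\in\{1,\dots,t\}$ such that $$A(x)=O_k \quad\text{and}\quad B(x)=\mathcal O_k .$$ -/

import Mathlib

open MeasureTheory ProbabilityTheory
open scoped ComplexOrder

noncomputable section

/-- The standard circularly symmetric complex Gaussian law: independent centred real Gaussian
real and imaginary parts, each of variance `1 / 2`, so that the second absolute moment is `1`. -/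
def stdComplexGaussian : Measure ℂ :=
  ((gaussianReal 0 (1 / 2)).prod (gaussianReal 0 (1 / 2))).map
    (fun p : ℝ × ℝ => (⟨p.1, p.2⟩ : ℂ))

/-- The set of minimizers of `f` over `S`. -/
def argminOn {α : Type*} (S : Set α) (f : α → ℝ) : Set α :=
  {a | a ∈ S ∧ ∀ b ∈ S, f a ≤ f b}

/-- Nonnegative weight vectors of total weight at most `1`. -/
def weightSet (t : ℕ) : Set (Fin t → ℝ) :=
  {q | (∀ i, 0 ≤ q i) ∧ ∑ i, q i ≤ 1}

/-- Complex positive semidefinite (in particular Hermitian) matrices of trace at most `1`. -/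
def covarianceSet (t : ℕ) : Set (Matrix (Fin t) (Fin t) ℂ) :=
  {Q | Q.PosSemidef ∧ Q.trace.re ≤ 1}

/-- The vector `(1/k, …, 1/k, 0, …, 0)` with `k` leading entries `1/k`. -/
def uniformWeights (t k : ℕ) : Fin t → ℝ :=
  fun i => if (i : ℕ) < k then 1 / (k : ℝ) else 0

/-- All permutations of `(1/k, …, 1/k, 0, …, 0)`. -/
def permutationOrbit (t k : ℕ) : Set (Fin t → ℝ) :=
  {q | ∃ σ : Equiv.Perm (Fin t), q = fun i => uniformWeights t k (σ i)}

/-- All unitary conjugates of `diag (1/k, …, 1/k, 0, …, 0)`. -/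
def unitaryOrbit (t k : ℕ) : Set (Matrix (Fin t) (Fin t) ℂ) :=
  {Q | ∃ U ∈ Matrix.unitaryGroup (Fin t) ℂ,
    Q = U * Matrix.diagonal (fun i => (uniformWeights t k i : ℂ)) * star U}

/-- The probability that `∑ i, q i * X i` is at most `x`. -/
def weightedSumCdf {t : ℕ} {Ω : Type*} [MeasurableSpace Ω] (P : Measure Ω)
    (X : Fin t → Ω → ℝ) (x : ℝ) (q : Fin t → ℝ) : ℝ :=
  P.real {ω | ∑ i, q i * X i ω ≤ x}

/-- The MISO outage probability: the probability that `H Q H*` is at most `x`, for the random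
row vector `H`. For Hermitian `Q` the number `H Q H*` is real. -/
def outageProbability {t : ℕ} {Ω : Type*} [MeasurableSpace Ω] (P : Measure Ω)
    (H : Fin t → Ω → ℂ) (x : ℝ) (Q : Matrix (Fin t) (Fin t) ℂ) : ℝ :=
  P.real {ω | (∑ i, ∑ j, H i ω * Q i j * star (H j ω)).re ≤ x}

end

/-!
Write `E_a` for the operator sending a function `g` on `[0, ∞)` to the expectation of
`g (x - a X)`, where `X` is a standard exponential variable and `g` vanishes to the left of `0`.
For `a > 0` the function `u = E_a g` is the solution of `u + a u' = g`, `u 0 = 0`. Hence these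
operators commute and satisfy the resolvent identity `(a - b) E_a E_b = a E_a - b E_b`, and the
distribution function of `∑ q_i X_i` is `∏ E_{q_i}` applied to the constant `1`. Let
`D_a = (1 - E_a) / a`, so that `D_a g` is the derivative of `E_a g`. For `a + b = a' + b'` there is
the exact increment
`E_a' E_b' - E_a E_b = (a b - a' b') D_a D_b E_a' E_b'` (`es_mul_es_sub`).

Let `q` minimize `F q = ∏ E_{q_i} 1 (x)` and put `Q = ∏ E_{q_i}`. The total weight is `1`, because
densities are positive. Moving mass between two positive weights `a ≠ b` gives the first-order
condition `D_a D_b Q 1 (x) = 0` and the second-order condition `(D_a D_b)² Q 1 (x) ≥ 0`, while two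
equal weights `b` give `D_b D_b Q 1 (x) ≥ 0`. The functions `D_a D_b r 1` are derivatives of
densities and change sign at most once, from `+` to `-` (`singleCrossing_ds_ds`), so where one
of them vanishes every further smoothing of it is still positive. Together with the resolvent
identity this excludes three distinct positive weights (`eq_or_eq_of_argmin`), and it excludes a
repeated smaller weight (`eq_of_argmin_of_lt`).

There remain `m ≥ 1` copies of `a` and a single `b < a`. Let `f` be the density with one more copy
of each weight, so that `f' (x) = 0`. The ratio `A` of `2 b E_b f` and `x f` satisfies a Riccati
equation in `x`, and the sign of the second-order term is governed by `A`. A comparison argument for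
that equation (`riccati_inequality`) shows that this term is negative (`second_neg_of_critical`), a
contradiction. So all positive weights are equal, and `F` takes equal values on permutations.
Minimizers exist because `F` is continuous on the compact set of weights.

Values of `F` at two different uniform weight vectors agree for finitely many `x` only: the
difference has derivative `c x^(k-1) exp (-k x) - c' x^(l-1) exp (-l x)`, which by Rolle's theorem
on a logarithmic scale has finitely many zeros (`finite_coincidence`).

For the outage problem, `Q = U diag(q) U*` gives `H Q H* = ∑ q_l |(H U)_l|²`. By unitary invariance
of the complex Gaussian law the numbers `|(H U)_l|²` are independent standard exponential variables,
so the outage probability of `Q` is `F q`.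
-/

/-! ### Exponential smoothing -/

open intervalIntegral in
/-- Convolution on `[0, ∞)` with the law of `a` times a standard exponential variable:
`(expSmooth a g) x = a⁻¹ ∫₀ˣ exp (-(x - y) / a) g y dy`, which is the expectation of `g (x - a X)`
when `g` is cut off at `0`. At `a = 0` the law is a point mass and the operator is the identity.
Only the values of the functions on `[0, ∞)` carry meaning. -/
noncomputable def expSmooth (a : ℝ) : Module.End ℝ C(ℝ, ℝ) :=
  if a = 0 then 1 else
  { toFun := fun g =>
      ⟨fun x => a⁻¹ * Real.exp (-x / a) * ∫ y in (0 : ℝ)..x, Real.exp (y / a) * g y, by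
        have h : Continuous fun x : ℝ => ∫ y in (0 : ℝ)..x, Real.exp (y / a) * g y :=
          continuous_primitive (fun _ _ => (by fun_prop : Continuous _).intervalIntegrable _ _) 0
        fun_prop⟩
    map_add' := fun f g => by
      ext x
      have : ∀ k : C(ℝ, ℝ), IntervalIntegrable (fun y => Real.exp (y / a) * k y) volume 0 x :=
        fun k => (by fun_prop : Continuous _).intervalIntegrable _ _
      simp only [ContinuousMap.coe_mk, ContinuousMap.add_apply, mul_add]
      rw [integral_add (this f) (this g)]
      ring
    map_smul' := fun c g => by
      ext x
      simp only [ContinuousMap.coe_mk, ContinuousMap.smul_apply, smul_eq_mul, RingHom.id_apply,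
        mul_left_comm _ c]
      rw [intervalIntegral.integral_const_mul]
      ring }

lemma expSmooth_zero : expSmooth 0 = 1 := by simp [expSmooth]

lemma expSmooth_apply {a : ℝ} (ha : a ≠ 0) (g : C(ℝ, ℝ)) (x : ℝ) :
    expSmooth a g x = a⁻¹ * Real.exp (-x / a) * ∫ y in (0 : ℝ)..x, Real.exp (y / a) * g y := by
  simp [expSmooth, ha]

lemma expSmooth_apply_zero {a : ℝ} (ha : a ≠ 0) (g : C(ℝ, ℝ)) : expSmooth a g 0 = 0 := by
  simp [expSmooth_apply ha]

lemma hasDerivAt_expSmooth {a : ℝ} (ha : a ≠ 0) (g : C(ℝ, ℝ)) (x : ℝ) :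
    HasDerivAt (expSmooth a g) ((g x - expSmooth a g x) / a) x := by
  have h1 : HasDerivAt (fun x => ∫ y in (0 : ℝ)..x, Real.exp (y / a) * g y)
      (Real.exp (x / a) * g x) x :=
    intervalIntegral.integral_hasDerivAt_right
      ((by fun_prop : Continuous _).intervalIntegrable _ _)
      (Continuous.stronglyMeasurableAtFilter (by fun_prop) _ _)
      (Continuous.continuousAt (by fun_prop))
  have h2 : HasDerivAt (fun x : ℝ => a⁻¹ * Real.exp (-x / a))
      (a⁻¹ * (Real.exp (-x / a) * (-1 / a))) x :=
    (((hasDerivAt_id x).neg.div_const a).exp).const_mul _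
  have h3 := h2.mul h1
  have : (expSmooth a g : ℝ → ℝ) = (fun x : ℝ => a⁻¹ * Real.exp (-x / a)) *
      (fun x => ∫ y in (0 : ℝ)..x, Real.exp (y / a) * g y) := by
    ext y; simp [expSmooth_apply ha]
  rw [this]
  refine h3.congr_deriv ?_
  have : Real.exp (-(x / a)) * Real.exp (x / a) = 1 := by
    rw [← Real.exp_add, neg_add_cancel, Real.exp_zero]
  rw [Pi.mul_apply]
  field_simp
  linear_combination a * g x * this

/-- `expSmooth a g` is the only solution of `u + a u' = g`, `u 0 = 0`. All algebraic identities
between smoothing operators come from this characterization. -/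
lemma eq_expSmooth {a : ℝ} (ha : a ≠ 0) {g u : C(ℝ, ℝ)} (h0 : u 0 = 0)
    (hu : ∀ x, HasDerivAt u ((g x - u x) / a) x) : u = expSmooth a g := by
  have hd : ∀ x, HasDerivAt (fun x => Real.exp (x / a) * (u x - expSmooth a g x)) 0 x := by
    intro x
    have h := (((hasDerivAt_id x).div_const a).exp).mul ((hu x).sub (hasDerivAt_expSmooth ha g x))
    refine h.congr_deriv ?_
    simp only [id, Pi.sub_apply]
    field_simp
    ring
  ext x
  have h := is_const_of_deriv_eq_zero (fun x => (hd x).differentiableAt) (fun x => (hd x).deriv) x 0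
  simp only [h0, expSmooth_apply_zero ha, sub_self, mul_zero, mul_eq_zero, (Real.exp_pos _).ne',
    false_or] at h
  linarith

/-- The resolvent identity. -/
lemma expSmooth_resolvent (a b : ℝ) :
    (a - b) • (expSmooth a * expSmooth b) = a • expSmooth a - b • expSmooth b := by
  rcases eq_or_ne a 0 with rfl | ha
  · ext g x; simp [expSmooth_zero]
  rcases eq_or_ne b 0 with rfl | hb
  · ext g x; simp [expSmooth_zero]
  refine LinearMap.ext fun g => ?_
  -- `u = E_a E_b g` satisfies `E_a g = u + b u'` and `E_b g = u + a u'`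
  set v := expSmooth b g
  set u := expSmooth a v
  have hu : ∀ x, HasDerivAt u ((v x - u x) / a) x := hasDerivAt_expSmooth ha v
  have hv : ∀ x, HasDerivAt v ((g x - v x) / b) x := hasDerivAt_expSmooth hb g
  have key : u + (b / a) • (v - u) = expSmooth a g := by
    refine eq_expSmooth ha ?_ fun x => ?_
    · simp [u, v, expSmooth_apply_zero ha, expSmooth_apply_zero hb]
    · have := (hu x).add (((hv x).sub (hu x)).const_mul (b / a))
      refine this.congr_deriv ?_
      simp only [ContinuousMap.add_apply, ContinuousMap.smul_apply, ContinuousMap.sub_apply,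
        smul_eq_mul]
      field_simp
      ring
  have : (a - b) • u = a • expSmooth a g - b • v := by
    rw [← key]
    ext x
    simp only [ContinuousMap.add_apply, ContinuousMap.smul_apply, ContinuousMap.sub_apply,
        smul_eq_mul]
    field_simp
    ring
  exact this

lemma expSmooth_comm (a b : ℝ) : expSmooth a * expSmooth b = expSmooth b * expSmooth a := by
  rcases eq_or_ne a b with rfl | h
  · rfl
  · have h1 := expSmooth_resolvent a b
    have h2 := expSmooth_resolvent b a
    have h3 : (a - b) • (expSmooth a * expSmooth b) = (a - b) • (expSmooth b * expSmooth a) := by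
      have : (a - b) • (expSmooth b * expSmooth a) = -((b - a) • (expSmooth b * expSmooth a)) := by
        ext g x; simp; ring
      rw [h1, this, h2, neg_sub]
    exact smul_right_injective _ (sub_ne_zero.2 h) h3

/-- The algebra of operators generated by all smoothing operators. -/
abbrev SmoothAlg : Subalgebra ℝ (Module.End ℝ C(ℝ, ℝ)) := Algebra.adjoin ℝ (Set.range expSmooth)

instance : IsMulCommutative SmoothAlg :=
  Algebra.isMulCommutative_adjoin ℝ (by rintro _ ⟨a, rfl⟩ _ ⟨b, rfl⟩; exact expSmooth_comm a b)

open scoped IsMulCommutative in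
instance : CommRing SmoothAlg := inferInstance

/-- The smoothing operator as an element of the commutative algebra `SmoothAlg`. -/
noncomputable def es (a : ℝ) : SmoothAlg := ⟨expSmooth a, Algebra.subset_adjoin ⟨a, rfl⟩⟩

lemma es_smul (a : ℝ) (g : C(ℝ, ℝ)) : es a • g = expSmooth a g := rfl

lemma es_zero : es 0 = 1 := Subtype.ext expSmooth_zero

lemma es_resolvent (a b : ℝ) : (a - b) • (es a * es b) = a • es a - b • es b :=
  Subtype.ext (expSmooth_resolvent a b)

/-- The operator `g ↦ (expSmooth a g)'`, for `a ≠ 0`. -/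
noncomputable def ds (a : ℝ) : SmoothAlg := a⁻¹ • (1 - es a)

lemma smul_ds {a : ℝ} (ha : a ≠ 0) : a • ds a = 1 - es a := by
  rw [ds, smul_smul, mul_inv_cancel₀ ha, one_smul]

lemma ds_mul_es {a c : ℝ} (ha : a ≠ 0) (hc : c ≠ 0) : ds a * es c = ds c * es a := by
  have h := es_resolvent a c
  refine smul_right_injective _ (mul_ne_zero ha hc) ?_
  have h1 : (a * c) • (ds a * es c) = c • ((a • ds a) * es c) := by algebra
  have h2 : (a * c) • (ds c * es a) = a • ((c • ds c) * es a) := by algebra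
  simp only [h1, h2, smul_ds ha, smul_ds hc]
  linear_combination (norm := algebra) (1 : SmoothAlg) * h

lemma es_sub_es {a : ℝ} (ha : a ≠ 0) (a' : ℝ) :
    es a' - es a = (a - a') • (ds a * es a') := by
  have h := es_resolvent a' a
  refine smul_right_injective _ ha ?_
  have h1 : a • ((a - a') • (ds a * es a')) = (a - a') • ((a • ds a) * es a') := by algebra
  simp only [h1, smul_ds ha]
  linear_combination (norm := algebra) (-1 : SmoothAlg) * h

/-- The exact increment when mass is moved between two weights. -/
lemma es_mul_es_sub {a b a' b' : ℝ} (ha : a ≠ 0) (hb : b ≠ 0) (h : a' + b' = a + b) :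
    es a' * es b' - es a * es b = (a * b - a' * b') • (ds a * ds b * es a' * es b') := by
  have h1 := es_sub_es ha a'
  have h2 := es_sub_es hb b'
  have h3 := es_sub_es hb a'
  have h4 := ds_mul_es ha hb
  obtain rfl : b' = a + b - a' := by linarith
  linear_combination (norm := algebra) es (a + b - a') * h1 + es a * h2
    + (a - a') • es (a + b - a') * h4 + (a - a') • ds a * es (a + b - a') * h3

/-! ### Positivity, bounds and single crossing -/

instance : IsScalarTower ℝ SmoothAlg C(ℝ, ℝ) := ⟨fun _ _ _ => rfl⟩

lemma es_smul_apply {a : ℝ} (ha : a ≠ 0) (g : C(ℝ, ℝ)) (x : ℝ) :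
    (es a • g) x = a⁻¹ * Real.exp (-x / a) * ∫ y in (0 : ℝ)..x, Real.exp (y / a) * g y :=
  expSmooth_apply ha g x

lemma es_zero_smul (g : C(ℝ, ℝ)) : es 0 • g = g := by rw [es_zero, one_smul]

lemma es_smul_apply_zero {a : ℝ} (ha : a ≠ 0) (g : C(ℝ, ℝ)) : (es a • g) 0 = 0 :=
  expSmooth_apply_zero ha g

lemma ds_smul (a : ℝ) (g : C(ℝ, ℝ)) : ds a • g = a⁻¹ • (g - es a • g) := by
  rw [ds, smul_assoc, sub_smul, one_smul]

lemma ds_smul_apply (a : ℝ) (g : C(ℝ, ℝ)) (x : ℝ) :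
    (ds a • g) x = (g x - (es a • g) x) / a := by
  rw [ds_smul, ContinuousMap.smul_apply, ContinuousMap.sub_apply, smul_eq_mul, div_eq_inv_mul]

lemma hasDerivAt_es_smul {a : ℝ} (ha : a ≠ 0) (g : C(ℝ, ℝ)) (x : ℝ) :
    HasDerivAt (es a • g : C(ℝ, ℝ)) ((ds a • g) x) x := by
  rw [ds_smul_apply]
  exact hasDerivAt_expSmooth ha g x

lemma eq_es_smul {a : ℝ} (ha : a ≠ 0) {g u : C(ℝ, ℝ)} (h0 : u 0 = 0)
    (hu : ∀ x, HasDerivAt u ((g x - u x) / a) x) : u = es a • g :=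
  eq_expSmooth ha h0 hu

lemma es_smul_nonneg {a x : ℝ} (ha : 0 ≤ a) (hx : 0 ≤ x) {g : C(ℝ, ℝ)}
    (hg : ∀ y ∈ Set.Icc 0 x, 0 ≤ g y) : 0 ≤ (es a • g) x := by
  rcases ha.eq_or_lt with rfl | ha
  · rw [es_zero_smul]; exact hg x ⟨hx, le_rfl⟩
  rw [es_smul_apply ha.ne']
  refine mul_nonneg (by positivity) (intervalIntegral.integral_nonneg hx fun y hy => ?_)
  exact mul_nonneg (Real.exp_pos _).le (hg y hy)

lemma es_smul_pos {a x : ℝ} (ha : 0 < a) (hx : 0 < x) {g : C(ℝ, ℝ)}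
    (hg : ∀ y ∈ Set.Ioo 0 x, 0 < g y) : 0 < (es a • g) x := by
  rw [es_smul_apply ha.ne']
  refine mul_pos (by positivity) (intervalIntegral.intervalIntegral_pos_of_pos_on
    ((by fun_prop : Continuous _).intervalIntegrable _ _) (fun y hy => ?_) hx)
  exact mul_pos (Real.exp_pos _) (hg y hy)

/-- The continuous function `x ↦ a⁻¹ exp (-x / a)`, the exponential density of mean `a` on
`[0, ∞)`. -/
noncomputable def expDensity (a : ℝ) : C(ℝ, ℝ) :=
  ⟨fun x => a⁻¹ * Real.exp (-x / a), by fun_prop⟩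

lemma expDensity_apply (a x : ℝ) : expDensity a x = a⁻¹ * Real.exp (-x / a) := rfl

lemma expDensity_pos {a : ℝ} (ha : 0 < a) (x : ℝ) : 0 < expDensity a x := by
  rw [expDensity_apply]; positivity

lemma hasDerivAt_expDensity (a x : ℝ) :
    HasDerivAt (expDensity a) (-(expDensity a x) / a) x := by
  have h2 : HasDerivAt (fun x : ℝ => a⁻¹ * Real.exp (-x / a))
      (a⁻¹ * (Real.exp (-x / a) * (-1 / a))) x :=
    (((hasDerivAt_id x).neg.div_const a).exp).const_mul _
  refine h2.congr_deriv ?_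
  rw [expDensity_apply]; ring

lemma ds_smul_one {a : ℝ} (ha : a ≠ 0) : ds a • (1 : C(ℝ, ℝ)) = expDensity a := by
  have : 1 - a • expDensity a = es a • (1 : C(ℝ, ℝ)) := by
    refine eq_es_smul ha ?_ fun x => ?_
    · simp [expDensity_apply, ha]
    · refine (((hasDerivAt_expDensity a x).const_mul a).const_sub 1).congr_deriv ?_
      simp only [ContinuousMap.sub_apply, ContinuousMap.one_apply, ContinuousMap.smul_apply,
        smul_eq_mul]
      field_simp
      ring
  rw [ds_smul, ← this, sub_sub_cancel, smul_smul, inv_mul_cancel₀ ha, one_smul]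

lemma abs_es_smul_le {a x M : ℝ} (ha : 0 ≤ a) (hx : 0 ≤ x) {g : C(ℝ, ℝ)}
    (hg : ∀ y ∈ Set.Icc 0 x, |g y| ≤ M) : |(es a • g) x| ≤ M := by
  have hM : 0 ≤ M := (abs_nonneg _).trans (hg x ⟨hx, le_rfl⟩)
  rcases ha.eq_or_lt with rfl | ha
  · rw [es_zero_smul]; exact hg x ⟨hx, le_rfl⟩
  have h1 : (es a • (1 : C(ℝ, ℝ))) x ≤ 1 := by
    have h := expDensity_pos ha x
    rw [← ds_smul_one ha.ne', ds_smul_apply, ContinuousMap.one_apply, div_pos_iff_of_pos_right ha]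
      at h
    linarith
  have h2 := es_smul_nonneg ha.le hx (g := M • 1 - g) fun y hy => by
    simpa using (abs_le.1 (hg y hy)).2
  have h3 := es_smul_nonneg ha.le hx (g := M • 1 + g) fun y hy => by
    have := (abs_le.1 (hg y hy)).1
    simp only [ContinuousMap.add_apply, ContinuousMap.smul_apply, ContinuousMap.one_apply,
      smul_eq_mul]
    linarith
  rw [smul_sub, smul_comm, ContinuousMap.sub_apply, ContinuousMap.smul_apply, smul_eq_mul] at h2
  rw [smul_add, smul_comm, ContinuousMap.add_apply, ContinuousMap.smul_apply, smul_eq_mul] at h3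
  have h4 : M * (es a • (1 : C(ℝ, ℝ))) x ≤ M := mul_le_of_le_one_right hM h1
  exact abs_le.2 ⟨by linarith, by linarith⟩

/-- The submonoid of products of smoothing operators with nonnegative parameters. -/
def smoothMonoid : Submonoid SmoothAlg := Submonoid.closure (es '' Set.Ici 0)

lemma es_mem {a : ℝ} (ha : 0 ≤ a) : es a ∈ smoothMonoid :=
  Submonoid.subset_closure ⟨a, ha, rfl⟩

lemma smoothMonoid_induction {p : SmoothAlg → Prop} (one : p 1)
    (mul : ∀ a r, 0 < a → p r → p (es a * r)) {r : SmoothAlg} (hr : r ∈ smoothMonoid) : p r := by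
  induction hr using Submonoid.closure_induction_left with
  | one => exact one
  | mul_left x hx y _ hy =>
    obtain ⟨a, ha, rfl⟩ := hx
    rcases (Set.mem_Ici.1 ha).eq_or_lt with rfl | ha
    · rwa [es_zero, one_mul]
    · exact mul a y ha hy

lemma abs_smul_le {r : SmoothAlg} (hr : r ∈ smoothMonoid) {x M : ℝ} (hx : 0 ≤ x)
    {g : C(ℝ, ℝ)} (hg : ∀ y ∈ Set.Icc 0 x, |g y| ≤ M) : |(r • g) x| ≤ M := by
  suffices ∀ y ∈ Set.Icc 0 x, |(r • g) y| ≤ M from this x ⟨hx, le_rfl⟩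
  refine smoothMonoid_induction (p := fun r => ∀ y ∈ Set.Icc 0 x, |(r • g) y| ≤ M) ?_ ?_ hr
  · simpa using hg
  · intro a r ha h y hy
    rw [mul_smul]
    exact abs_es_smul_le ha.le hy.1 fun z hz => h z ⟨hz.1, hz.2.trans hy.2⟩

lemma exists_abs_smul_le (g : C(ℝ, ℝ)) {x : ℝ} (hx : 0 ≤ x) :
    ∃ M, ∀ r ∈ smoothMonoid, |(r • g) x| ≤ M := by
  obtain ⟨M, hM⟩ := isCompact_Icc.exists_bound_of_continuousOn (s := Set.Icc 0 x)
    (f := g) g.continuous.continuousOn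
  exact ⟨M, fun r hr => abs_smul_le hr hx hM⟩

lemma smul_pos_of_pos {r : SmoothAlg} (hr : r ∈ smoothMonoid) {x : ℝ} (hx : 0 < x)
    {g : C(ℝ, ℝ)} (hg : ∀ y ∈ Set.Ioc 0 x, 0 < g y) : 0 < (r • g) x := by
  suffices ∀ y ∈ Set.Ioc 0 x, 0 < (r • g) y from this x ⟨hx, le_rfl⟩
  refine smoothMonoid_induction (p := fun r => ∀ y ∈ Set.Ioc 0 x, 0 < (r • g) y) ?_ ?_ hr
  · simpa using hg
  · intro a r ha h y hy
    rw [mul_smul]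
    exact es_smul_pos ha hy.1 fun z hz => h z ⟨hz.1, hz.2.le.trans hy.2⟩

/-- On `(0, ∞)` the function is positive to the left of every point where it is nonnegative: it
changes sign at most once, from positive to negative. -/
def SingleCrossing (φ : ℝ → ℝ) : Prop := ∀ ⦃y x⦄, 0 < y → y < x → 0 ≤ φ x → 0 < φ y

lemma SingleCrossing.es_smul {a : ℝ} (ha : 0 < a) {φ : C(ℝ, ℝ)} (h : SingleCrossing φ) :
    SingleCrossing (es a • φ : C(ℝ, ℝ)) := by
  intro y x hy hyx hx
  rw [es_smul_apply ha.ne'] at hx ⊢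
  have hc : Continuous fun y => Real.exp (y / a) * φ y := by fun_prop
  have hx := nonneg_of_mul_nonneg_right hx (by positivity)
  refine mul_pos (by positivity) ?_
  by_contra hI
  -- a nonpositive primitive at `y` forces a nonpositive value before `y`, after which `φ < 0`
  obtain ⟨v, hv, hφ⟩ : ∃ v ∈ Set.Ioo 0 y, φ v ≤ 0 := by
    by_contra! hcon
    exact hI (intervalIntegral.intervalIntegral_pos_of_pos_on (hc.intervalIntegrable _ _)
      (fun z hz => mul_pos (Real.exp_pos _) (hcon z hz)) hy)
  have hneg : ∀ w, v < w → φ w < 0 := fun w hw => by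
    by_contra! hcon
    exact absurd (h hv.1 hw hcon) hφ.not_gt
  have h2 : 0 < ∫ z in y..x, -(Real.exp (z / a) * φ z) :=
    intervalIntegral.intervalIntegral_pos_of_pos_on (hc.neg.intervalIntegrable _ _)
      (fun z hz => by
        have := mul_pos (Real.exp_pos (z / a)) (neg_pos.2 (hneg z (hv.2.trans hz.1)))
        linarith) hyx
  rw [intervalIntegral.integral_neg] at h2
  have h3 := intervalIntegral.integral_add_adjacent_intervals
    (hc.intervalIntegrable (μ := volume) 0 y) (hc.intervalIntegrable y x)
  linarith

/-- The derivative of the density of a sum of at least two exponential variables changes sign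
at most once. -/
lemma singleCrossing_ds_ds {a b : ℝ} (ha : 0 < a) (hb : 0 < b) {r : SmoothAlg}
    (hr : r ∈ smoothMonoid) : SingleCrossing ((ds a * ds b * r) • (1 : C(ℝ, ℝ)) : C(ℝ, ℝ)) := by
  rw [mul_comm, mul_smul]
  refine smoothMonoid_induction (p := fun r => SingleCrossing
    ((r • (ds a * ds b) • (1 : C(ℝ, ℝ)) : C(ℝ, ℝ)))) ?_ (fun c r hc h => ?_) hr
  · -- `w = D_b (expDensity a)` satisfies `w + b w' = (expDensity a)' < 0`
    rw [one_smul, mul_comm, mul_smul, ds_smul_one ha.ne']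
    set w := ds b • expDensity a with hw
    have hd : ∀ x, HasDerivAt (fun x => Real.exp (x / b) * w x)
        (Real.exp (x / b) * (-(expDensity a x) / (a * b))) x := by
      intro x
      have h1 : HasDerivAt w ((-(expDensity a x) / a - (ds b • expDensity a) x) / b) x := by
        have h := ((hasDerivAt_expDensity a x).sub
          (hasDerivAt_es_smul hb.ne' (expDensity a) x)).div_const b
        exact h.congr_of_eventuallyEq (.of_forall fun x => ds_smul_apply b _ x)
      refine ((((hasDerivAt_id x).div_const b).exp).mul h1).congr_deriv ?_
      rw [← hw]
      simp only [id]
      field_simp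
      ring
    have hanti : StrictAnti fun x => Real.exp (x / b) * w x :=
      strictAnti_of_hasDerivAt_neg hd fun x => by
        have := expDensity_pos ha x
        rw [neg_div, mul_neg, neg_lt_zero]
        positivity
    intro y x _ hyx hx
    have h := hanti hyx
    have : 0 ≤ Real.exp (x / b) * w x := by positivity
    exact pos_of_mul_pos_right (this.trans_lt h) (Real.exp_pos _).le
  · rw [mul_smul]
    exact h.es_smul hc

/-- The density of a sum of exponential variables is positive on `(0, ∞)`. -/
lemma smul_expDensity_pos {a : ℝ} (ha : 0 < a) {r : SmoothAlg} (hr : r ∈ smoothMonoid) {x : ℝ}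
    (hx : 0 < x) : 0 < (r • expDensity a) x :=
  smul_pos_of_pos hr hx fun y _ => expDensity_pos ha y

/-! ### Optimality conditions for a transfer between two weights -/

section Transfer

open Filter Topology

variable {a b x : ℝ} {R : SmoothAlg}

/-- Smoothing with two parameters of constant sum depends Lipschitz-continuously on their
product. -/
lemma exists_transfer_bound (ha : a ≠ 0) (hb : b ≠ 0) (hx : 0 ≤ x) (hR : R ∈ smoothMonoid)
    (r : SmoothAlg) : ∃ M, ∀ a' b', 0 ≤ a' → 0 ≤ b' → a' + b' = a + b →
      ∃ e : ℝ, |e| ≤ M ∧ e = ((ds a * ds b * r * (es a' * es b' * R)) • (1 : C(ℝ, ℝ))) x ∧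
      ((r * (es a' * es b' * R)) • (1 : C(ℝ, ℝ))) x =
        ((r * (es a * es b * R)) • (1 : C(ℝ, ℝ))) x + (a * b - a' * b') * e := by
  obtain ⟨M, hM⟩ := exists_abs_smul_le ((ds a * ds b * r) • (1 : C(ℝ, ℝ))) hx
  refine ⟨M, fun a' b' ha' hb' hab => ⟨_, ?_, rfl, ?_⟩⟩
  · rw [mul_comm, mul_smul]
    exact hM _ (mul_mem (mul_mem (es_mem ha') (es_mem hb')) hR)
  · have h := es_mul_es_sub ha hb hab
    have h1 : r * (es a' * es b' * R) = r * (es a * es b * R) +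
        (a * b - a' * b') • (ds a * ds b * r * (es a' * es b' * R)) := by
      linear_combination (norm := algebra) r * R * h
    rw [h1, add_smul, smul_assoc]
    simp

lemma tendsto_transfer (a b : ℝ) :
    Tendsto (fun δ : ℝ => δ * (a - b + δ)) (𝓝[>] 0) (𝓝 0) := by
  have : Continuous fun δ : ℝ => δ * (a - b + δ) := by fun_prop
  simpa using (this.tendsto 0).mono_left nhdsWithin_le_nhds

lemma nonneg_of_transfer_bound {V M : ℝ} (h : ∀ᶠ δ in 𝓝[>] (0 : ℝ), -(δ * (a - b + δ) * M) ≤ V) :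
    0 ≤ V := by
  have := ((tendsto_transfer a b).mul_const M).neg
  rw [zero_mul, neg_zero] at this
  exact le_of_tendsto this h

/-- No transfer between the weights `a` and `b` decreases the distribution function at `x`; the
remaining weights enter through `R`. The increment is written as in `es_mul_es_sub`. -/
def TransferOptimal (a b x : ℝ) (R : SmoothAlg) : Prop :=
  ∀ a' b', 0 ≤ a' → 0 ≤ b' → a' + b' = a + b →
    0 ≤ (a * b - a' * b') * ((ds a * ds b * (es a' * es b' * R)) • (1 : C(ℝ, ℝ))) x

lemma TransferOptimal.first_nonneg (H : TransferOptimal a b x R) (hb : 0 < b) (hab : b ≤ a)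
    (hx : 0 ≤ x) (hR : R ∈ smoothMonoid) :
    0 ≤ ((ds a * ds b * (es a * es b * R)) • (1 : C(ℝ, ℝ))) x := by
  obtain ⟨M, hM⟩ := exists_transfer_bound (hb.trans_le hab).ne' hb.ne' hx hR (ds a * ds b)
  refine nonneg_of_transfer_bound (a := a) (b := b) (M := M) ?_
  filter_upwards [Ioo_mem_nhdsGT hb] with δ hδ
  obtain ⟨e, he, -, h⟩ := hM (a + δ) (b - δ) (by linarith [hδ.1]) (by linarith [hδ.2]) (by ring)
  have h1 := H (a + δ) (b - δ) (by linarith [hδ.1]) (by linarith [hδ.2]) (by ring)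
  have hk : a * b - (a + δ) * (b - δ) = δ * (a - b + δ) := by ring
  have hpos : 0 < δ * (a - b + δ) := mul_pos hδ.1 (by linarith [hδ.1])
  rw [hk] at h h1
  have h2 := nonneg_of_mul_nonneg_right h1 hpos
  have h3 := mul_le_mul_of_nonneg_left (abs_le.1 he).2 hpos.le
  linarith

lemma TransferOptimal.first_nonpos (H : TransferOptimal a b x R) (hb : 0 < b) (hab : b < a)
    (hx : 0 ≤ x) (hR : R ∈ smoothMonoid) :
    ((ds a * ds b * (es a * es b * R)) • (1 : C(ℝ, ℝ))) x ≤ 0 := by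
  obtain ⟨M, hM⟩ := exists_transfer_bound (hb.trans hab).ne' hb.ne' hx hR (ds a * ds b)
  rw [← neg_nonneg]
  refine nonneg_of_transfer_bound (a := a) (b := b) (M := M) ?_
  filter_upwards [Ioo_mem_nhdsGT (hb.trans hab), Ioo_mem_nhdsGT (sub_pos.2 hab)] with δ hδ hδ'
  obtain ⟨e, he, -, h⟩ := hM (a - δ) (b + δ) (by linarith [hδ.2]) (by linarith [hδ.1]) (by ring)
  have h1 := H (a - δ) (b + δ) (by linarith [hδ.2]) (by linarith [hδ.1]) (by ring)
  have hk : a * b - (a - δ) * (b + δ) = -(δ * (a - b - δ)) := by ring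
  have hpos : 0 < δ * (a - b - δ) := mul_pos hδ.1 (by linarith [hδ'.2])
  rw [hk] at h h1
  have h2 := nonpos_of_mul_nonneg_right h1 (neg_lt_zero.2 hpos)
  have h3 := mul_le_mul_of_nonneg_left (abs_le.1 he).2 hpos.le
  have hM0 : 0 ≤ M := (abs_nonneg _).trans he
  have h4 : δ * (a - b - δ) * M ≤ δ * (a - b + δ) * M := by
    gcongr
    · exact hδ.1.le
    · linarith [hδ.1]
  linarith

lemma TransferOptimal.second_nonneg (H : TransferOptimal a b x R) (hb : 0 < b) (hab : b < a)
    (hx : 0 ≤ x) (hR : R ∈ smoothMonoid) :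
    0 ≤ ((ds a * ds b * (ds a * ds b) * (es a * es b * R)) • (1 : C(ℝ, ℝ))) x := by
  have h0 := le_antisymm (H.first_nonpos hb hab hx hR) (H.first_nonneg hb hab.le hx hR)
  obtain ⟨M, hM⟩ := exists_transfer_bound (hb.trans hab).ne' hb.ne' hx hR (ds a * ds b)
  obtain ⟨M', hM'⟩ := exists_transfer_bound (hb.trans hab).ne' hb.ne' hx hR
    (ds a * ds b * (ds a * ds b))
  refine nonneg_of_transfer_bound (a := a) (b := b) (M := M') ?_
  filter_upwards [Ioo_mem_nhdsGT hb] with δ hδ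
  obtain ⟨e, -, he, h⟩ := hM (a + δ) (b - δ) (by linarith [hδ.1]) (by linarith [hδ.2]) (by ring)
  obtain ⟨e', he', -, h'⟩ :=
    hM' (a + δ) (b - δ) (by linarith [hδ.1]) (by linarith [hδ.2]) (by ring)
  have h1 := H (a + δ) (b - δ) (by linarith [hδ.1]) (by linarith [hδ.2]) (by ring)
  have hk : a * b - (a + δ) * (b - δ) = δ * (a - b + δ) := by ring
  have hpos : 0 < δ * (a - b + δ) := mul_pos hδ.1 (by linarith [hδ.1])
  rw [hk] at h h' h1
  rw [← he] at h'
  rw [h, h0, zero_add, ← mul_assoc] at h1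
  have h2 := nonneg_of_mul_nonneg_right h1 (mul_pos hpos hpos)
  have h3 := mul_le_mul_of_nonneg_left (abs_le.1 he').2 hpos.le
  linarith

end Transfer

/-! ### Consequences for optimal weights -/

section Weights

open Finset

variable {t : ℕ}

/-- The product of the smoothing operators of a weight vector. -/
noncomputable def smoothProd (q : Fin t → ℝ) : SmoothAlg := ∏ i, es (q i)

lemma smoothProd_mem {q : Fin t → ℝ} (hq : ∀ i, 0 ≤ q i) : smoothProd q ∈ smoothMonoid :=
  Submonoid.prod_mem _ fun i _ => es_mem (hq i)

/-- The distribution function at `x` of the sum of independent exponentials with weights `q`. -/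
noncomputable def smoothCdf (x : ℝ) (q : Fin t → ℝ) : ℝ := (smoothProd q • (1 : C(ℝ, ℝ))) x

lemma smoothProd_eq {i j : Fin t} (hij : i ≠ j) (q : Fin t → ℝ) :
    smoothProd q = es (q i) * es (q j) * ∏ l ∈ (univ.erase i).erase j, es (q l) := by
  rw [smoothProd, ← mul_prod_erase univ (fun i => es (q i)) (mem_univ i),
    ← mul_prod_erase (univ.erase i) (fun i => es (q i)) (mem_erase.2 ⟨hij.symm, mem_univ j⟩),
    mul_assoc]

lemma sum_eq_pair {i j : Fin t} (hij : i ≠ j) (q : Fin t → ℝ) :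
    ∑ i, q i = q i + q j + ∑ l ∈ (univ.erase i).erase j, q l := by
  rw [← add_sum_erase univ q (mem_univ i),
    ← add_sum_erase (univ.erase i) q (mem_erase.2 ⟨hij.symm, mem_univ j⟩), add_assoc]

variable {x : ℝ} {q : Fin t → ℝ}

/-- Two positive weights of a minimizer are optimal for transfers between them. -/
lemma transferOptimal_of_argmin (hq : q ∈ argminOn (weightSet t) (smoothCdf x)) {i j : Fin t}
    (hij : i ≠ j) (hi : 0 < q i) (hj : 0 < q j) :
    ∃ R ∈ smoothMonoid, smoothProd q = es (q i) * es (q j) * R ∧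
      TransferOptimal (q i) (q j) x R := by
  refine ⟨_, Submonoid.prod_mem _ fun l _ => es_mem (hq.1.1 l), smoothProd_eq hij q, ?_⟩
  intro a' b' ha' hb' hab
  set q' := Function.update (Function.update q i a') j b' with hq'
  have h1 : q' i = a' := by simp [hq', hij]
  have h2 : q' j = b' := by simp [hq']
  have h3 : ∀ l ∈ (univ.erase i).erase j, q' l = q l := fun l hl => by
    simp only [mem_erase] at hl
    simp [hq', hl.1, hl.2.1]
  have hmem : q' ∈ weightSet t := by
    refine ⟨fun l => ?_, ?_⟩
    · by_cases hl : l = j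
      · simpa [hl, h2]
      by_cases hl' : l = i
      · simpa [hl', h1]
      simpa [hq', hl, hl'] using hq.1.1 l
    · have := hq.1.2
      rw [sum_eq_pair hij] at this ⊢
      rw [h1, h2, sum_congr rfl h3]
      linarith
  have hle := hq.2 q' hmem
  rw [smoothCdf, smoothCdf, smoothProd_eq hij q, smoothProd_eq hij q', h1, h2,
    prod_congr rfl fun l hl => congrArg es (h3 l hl)] at hle
  set R := ∏ l ∈ (univ.erase i).erase j, es (q l)
  have h := es_mul_es_sub hi.ne' hj.ne' hab
  have h5 : es a' * es b' * R = es (q i) * es (q j) * R +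
      (q i * q j - a' * b') • (ds (q i) * ds (q j) * (es a' * es b' * R)) := by
    linear_combination (norm := algebra) R * h
  rw [h5, add_smul, smul_assoc] at hle
  simpa using hle

/-- The distribution function decreases strictly in each weight, so a minimizer uses all the
mass. -/
lemma sum_eq_one_of_argmin (ht : 1 ≤ t) (hx : 0 < x)
    (hq : q ∈ argminOn (weightSet t) (smoothCdf x)) : ∑ i, q i = 1 := by
  refine le_antisymm hq.1.2 (not_lt.1 fun hlt => ?_)
  let i : Fin t := ⟨0, ht⟩
  set a' := q i + (1 - ∑ i, q i) with ha'
  have hpos : 0 < a' := by linarith [hq.1.1 i]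
  set q' := Function.update q i a' with hq'
  have h3 : ∀ l ∈ univ.erase i, q' l = q l := fun l hl => by
    simp [hq', (mem_erase.1 hl).1]
  have hmem : q' ∈ weightSet t := by
    refine ⟨fun l => ?_, ?_⟩
    · by_cases hl : l = i
      · simpa [hq', hl] using hpos.le
      simpa [hq', hl] using hq.1.1 l
    · rw [← add_sum_erase univ q' (mem_univ i), sum_congr rfl h3]
      have := add_sum_erase univ q (mem_univ i)
      simp only [hq', Function.update_self]
      linarith
  have hle := hq.2 q' hmem
  rw [smoothCdf, smoothCdf, smoothProd, smoothProd,
    ← mul_prod_erase univ (fun l => es (q l)) (mem_univ i),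
    ← mul_prod_erase univ (fun l => es (q' l)) (mem_univ i),
    prod_congr rfl fun l hl => congrArg es (h3 l hl)] at hle
  simp only [hq', Function.update_self] at hle
  set R := ∏ l ∈ univ.erase i, es (q l)
  have hR : R ∈ smoothMonoid := Submonoid.prod_mem _ fun l _ => es_mem (hq.1.1 l)
  have h := es_sub_es hpos.ne' (q i)
  have h5 : es (q i) * R = es a' * R + (a' - q i) • ((es (q i) * R) * ds a') := by
    linear_combination (norm := algebra) R * h
  rw [h5, add_smul, smul_assoc, mul_smul _ (ds a'), ds_smul_one hpos.ne'] at hle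
  have := smul_expDensity_pos hpos (mul_mem (es_mem (hq.1.1 i)) hR) hx
  have : 0 < (a' - q i) * ((es (q i) * R) • expDensity a') x := mul_pos (by linarith) this
  simp only [ContinuousMap.add_apply, ContinuousMap.smul_apply, smul_eq_mul] at hle
  linarith

/-- First-order condition: `x` is a critical point of the density of the sum with one more copy of
each of two distinct positive weights. -/
lemma critical_of_argmin (hx : 0 < x) (hq : q ∈ argminOn (weightSet t) (smoothCdf x))
    {i j : Fin t} (hi : 0 < q i) (hj : 0 < q j) (hij : q i ≠ q j) :
    ((ds (q i) * ds (q j) * smoothProd q) • (1 : C(ℝ, ℝ))) x = 0 := by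
  wlog h : q j < q i generalizing i j
  · rw [mul_comm (ds (q i))]
    exact this hj hi hij.symm (lt_of_le_of_ne (not_lt.1 h) hij)
  obtain ⟨R, hR, h1, H⟩ := transferOptimal_of_argmin hq (fun h => hij (congrArg q h)) hi hj
  rw [h1]
  exact le_antisymm (H.first_nonpos hj h hx.le hR) (H.first_nonneg hj h.le hx.le hR)

/-- At a critical point of a density, every further smoothing of the density still increases. -/
lemma critical_mul_pos {a b c : ℝ} {r : SmoothAlg} (ha : 0 < a) (hb : 0 < b) (hc : 0 < c)
    (hr : r ∈ smoothMonoid) (hx : 0 < x)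
    (h : ((ds a * ds b * r) • (1 : C(ℝ, ℝ))) x = 0) :
    0 < ((es c * (ds a * ds b * r)) • (1 : C(ℝ, ℝ))) x := by
  rw [mul_smul]
  exact es_smul_pos hc hx fun y hy => singleCrossing_ds_ds ha hb hr hy.1 hy.2 h.ge

/-- The resolvent identity for densities sharing one of the smoothing parameters. -/
lemma resolvent_ds {a b c : ℝ} (hb : b ≠ 0) (hc : c ≠ 0) (r : SmoothAlg) :
    (b - c) • (es c * (ds a * ds b * r)) = b • (ds a * ds b * r) - c • (ds a * ds c * r) := by
  have h := ds_mul_es hb hc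
  have h1 := smul_ds hb
  have h2 := smul_ds hc
  linear_combination (norm := algebra) (-c) • (ds a * r) * h + (es c - 1) * ds a * r * h1
    + (1 - es b) * ds a * r * h2

end Weights

/-! ### A Riccati inequality -/

section Riccati

/-- The pointwise algebra behind `riccati_inequality`: where that inequality fails, `p` lies below
`2 / (m + 3)` and has positive derivative. -/
lemma riccati_algebra {m z A B C p : ℝ} (hm : 1 ≤ m) (hz : 0 < z) (hA0 : 0 < A) (hA1 : A < 1)
    (hB : B = m + 2 - z * A) (hzA : z * A < 2) (hC : C = B + z) (hp : p = 2 - A * C)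
    (h : (m + 1) * p * C ^ 2 ≤ 2 * (1 - p) * B ^ 2) :
    p < 2 / (m + 3) ∧ (p - A) * C + z * A * (1 - p) < 0 := by
  have hB0 : 0 < B := by linarith
  have hBC : B < C := by linarith
  have hC0 : 0 < C := by linarith
  have hB2 : 0 < B ^ 2 := by positivity
  have hC2 : 0 < C ^ 2 := by positivity
  have hsq : B ^ 2 < C ^ 2 := by gcongr
  have hp1 : 0 < 1 - p := by
    by_contra! hcon
    have h1 : 2 * (1 - p) * B ^ 2 ≤ 0 := by
      have := mul_nonpos_of_nonpos_of_nonneg hcon hB2.le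
      linarith
    have h2 : 0 < (m + 1) * p * C ^ 2 := by
      have : 0 < p := by linarith
      have : 0 < m + 1 := by linarith
      positivity
    linarith
  have hp3 : p * (m + 3) < 2 := by
    have h1 : 2 * (1 - p) * B ^ 2 < 2 * (1 - p) * C ^ 2 := by gcongr
    have h2 : (m + 1) * p < 2 * (1 - p) := lt_of_mul_lt_mul_right (h.trans_lt h1) hC2.le
    linarith
  refine ⟨by rw [lt_div_iff₀ (by linarith)]; exact hp3, ?_⟩
  have hAB : A * B = B - m - p := by
    rw [hp, hC]; linear_combination -hB
  have hrel : C * (B - m - p) = (2 - p) * B := by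
    rw [← hAB, hp]; ring
  have hN : ((p - A) * C + z * A * (1 - p)) * (B * C) =
      p * (m + p) * C ^ 2 - (2 - p) * (1 - p) * B ^ 2 := by
    have h1 : z * A = m + 2 - B := by linarith
    have h2 : (p - A) * C = p * C - (2 - p) := by rw [hp]; ring
    rw [h1, h2]
    linear_combination (p * C - (1 - p) * B) * hrel
  have hlt : p * (m + p) * C ^ 2 < (2 - p) * (1 - p) * B ^ 2 := by
    have hR : 0 < (2 - p) * (1 - p) * B ^ 2 := by
      have : 0 < 2 - p := by linarith
      positivity
    rcases le_or_gt p 0 with hp0 | hp0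
    · have hpm : 0 ≤ m + p := by
        have := mul_lt_mul_of_pos_right hA1 hB0
        linarith
      have : p * (m + p) * C ^ 2 ≤ 0 :=
        mul_nonpos_of_nonpos_of_nonneg (mul_nonpos_of_nonpos_of_nonneg hp0 hpm) hC2.le
      linarith
    · have h1 : (2 - p) * ((m + 1) * p * C ^ 2) ≤ (2 - p) * (2 * (1 - p) * B ^ 2) := by
        have : 0 ≤ 2 - p := by linarith
        gcongr
      have h2 : 0 < p * C ^ 2 * (2 - p * (m + 3)) := by
        have : 0 < 2 - p * (m + 3) := by linarith
        positivity
      linarith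
  by_contra! hcon
  have : 0 ≤ ((p - A) * C + z * A * (1 - p)) * (B * C) := by positivity
  linarith

variable {m : ℕ} {A : ℝ → ℝ}

/-- A bounded solution of the Riccati equation stays below its limit at `0`. -/
lemma riccati_le (hA : ∀ z, 0 < z → HasDerivAt A ((2 - (m + 3) * A z) / z - A z * (1 - A z)) z)
    (hA0 : ∀ z, 0 < z → 0 < A z) (hA1 : ∀ z, 0 < z → A z < 1) {z : ℝ} (hz : 0 < z) :
    A z ≤ 2 / (m + 3) := by
  have hm : (0 : ℝ) < m + 3 := by positivity
  have hd : ∀ x, 0 < x → HasDerivAt (fun x => x ^ (m + 3) * (A x - 2 / (m + 3)))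
      (-(x ^ (m + 3) * (A x * (1 - A x)))) x := by
    intro x hx
    refine ((hasDerivAt_pow (m + 3) x).mul ((hA x hx).sub_const _)).congr_deriv ?_
    have : m + 3 - 1 = m + 2 := rfl
    rw [this]
    push_cast
    field_simp
    ring
  have hanti : AntitoneOn (fun x => x ^ (m + 3) * (A x - 2 / (m + 3))) (Set.Ioi 0) := by
    refine antitoneOn_of_deriv_nonpos (convex_Ioi 0)
      (fun x hx => (hd x hx).continuousAt.continuousWithinAt)
      (fun x hx => (hd x (interior_subset hx)).differentiableAt.differentiableWithinAt)
      fun x hx => ?_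
    have hx : 0 < x := interior_subset hx
    rw [(hd x hx).deriv, neg_nonpos]
    have := hA0 x hx
    have : 0 < 1 - A x := by linarith [hA1 x hx]
    positivity
  have hle : z ^ (m + 3) * (A z - 2 / (m + 3)) ≤ 0 := by
    have hlim : Filter.Tendsto (fun x : ℝ => x ^ (m + 3)) (nhdsWithin 0 (Set.Ioi 0)) (nhds 0) := by
      have : Continuous fun x : ℝ => x ^ (m + 3) := by fun_prop
      simpa using (this.tendsto 0).mono_left nhdsWithin_le_nhds
    refine ge_of_tendsto hlim ?_
    filter_upwards [Ioo_mem_nhdsGT hz] with x hx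
    refine (hanti (Set.mem_Ioi.2 hx.1) (Set.mem_Ioi.2 hz) hx.2.le).trans ?_
    refine mul_le_of_le_one_right (pow_nonneg hx.1.le _) ?_
    have : 0 < 2 / ((m : ℝ) + 3) := by positivity
    linarith [hA1 x hx.1]
  have := nonpos_of_mul_nonpos_right hle (pow_pos hz _)
  linarith

/-- The second-order inequality for a solution `A` of a Riccati equation. With `p = (z A)'`, the
difference `(m + 1) p C² - 2 (1 - p) B²` vanishes at `z = 0`, and wherever it is nonpositive `p`
increases. A nonpositive value would therefore propagate back to `0` and contradict
`p → 2 / (m + 3)`. -/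
lemma riccati_inequality (hm : 1 ≤ m)
    (hA : ∀ z, 0 < z → HasDerivAt A ((2 - (m + 3) * A z) / z - A z * (1 - A z)) z)
    (hA0 : ∀ z, 0 < z → 0 < A z) (hA1 : ∀ z, 0 < z → A z < 1) (hzA : ∀ z, 0 < z → z * A z < 2)
    {z B C p : ℝ} (hz : 0 < z) (hB : B = m + 2 - z * A z) (hC : C = B + z)
    (hp : p = 2 - A z * C) : 2 * (1 - p) * B ^ 2 < (m + 1) * p * C ^ 2 := by
  have hm' : (1 : ℝ) ≤ m := by exact_mod_cast hm
  by_contra! hcon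
  set fB : ℝ → ℝ := fun x => m + 2 - x * A x with hfB
  set fC : ℝ → ℝ := fun x => m + 2 - x * A x + x with hfC
  set fp : ℝ → ℝ := fun x => 2 - A x * fC x with hfp
  have dB : ∀ x, 0 < x → HasDerivAt fB (-fp x) x := by
    intro x hx
    refine (((hasDerivAt_id x).mul (hA x hx)).const_sub ((m : ℝ) + 2)).congr_deriv ?_
    simp only [hfp, hfC, id]
    field_simp
    ring
  have dC : ∀ x, 0 < x → HasDerivAt fC (1 - fp x) x := by
    intro x hx
    exact ((dB x hx).add (hasDerivAt_id x)).congr_deriv (by ring)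
  have dp : ∀ x, 0 < x → HasDerivAt fp
      (-((fp x - A x) * fC x + x * A x * (1 - fp x)) / x) x := by
    intro x hx
    refine (((hA x hx).mul (dC x hx)).const_sub 2).congr_deriv ?_
    simp only [hfp, hfC]
    field_simp
    ring
  -- the inequality to be proved is `0 < F z`
  set F : ℝ → ℝ := fun x => (m + 1) * fp x * fC x ^ 2 - 2 * (1 - fp x) * fB x ^ 2 with hF
  have key : ∀ x, 0 < x → F x ≤ 0 → fp x < 2 / (m + 3) ∧
      0 < -((fp x - A x) * fC x + x * A x * (1 - fp x)) / x := by
    intro x hx hFx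
    have := riccati_algebra hm' hx (hA0 x hx) (hA1 x hx) (B := fB x) (C := fC x) (p := fp x)
      rfl (hzA x hx) rfl rfl (by linarith)
    exact ⟨this.1, div_pos (by linarith [this.2]) hx⟩
  have dF : ∀ x, 0 < x → HasDerivAt F ((m + 1) * (-((fp x - A x) * fC x + x * A x * (1 - fp x)) / x)
      * fC x ^ 2 + (m + 1) * fp x * (2 * fC x * (1 - fp x))
      - (2 * (-(-((fp x - A x) * fC x + x * A x * (1 - fp x)) / x)) * fB x ^ 2
        + 2 * (1 - fp x) * (2 * fB x * -fp x))) x := by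
    intro x hx
    refine ((((dp x hx).const_mul ((m : ℝ) + 1)).mul ((dC x hx).pow 2)).sub
      ((((dp x hx).const_sub 1).const_mul 2).mul ((dB x hx).pow 2))).congr_deriv ?_
    simp only [Pi.pow_apply, Nat.cast_ofNat]
    ring
  have hF0 : F z ≤ 0 := by
    have h1 : fB z = B := hB.symm
    have h2 : fC z = C := by rw [hC, hB]
    have h3 : fp z = p := by rw [hfp, hp, ← h2]
    simp only [hF, h1, h2, h3]
    linarith
  have hBpos : ∀ x, 0 < x → 0 < fB x := fun x hx => by
    have := hzA x hx
    simp only [hfB]; linarith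
  have hback : ∀ w, 0 < w → w ≤ z → F w ≤ 0 := by
    intro w hw hwz
    have hneg : ∀ x ∈ Set.Icc (-z) (-w), 0 < -x := fun x hx => by linarith [hx.2]
    have d : ∀ x ∈ Set.Icc (-z) (-w), HasDerivAt (fun x => F (-x)) _ x := fun x hx =>
      HasDerivAt.scomp x (dF (-x) (hneg x hx)) (hasDerivAt_neg x)
    have := image_le_of_deriv_right_lt_deriv_boundary' (f := fun x => F (-x)) (a := -z) (b := -w)
      (fun x hx => (d x hx).continuousAt.continuousWithinAt)
      (fun x hx => (d x ⟨hx.1, hx.2.le⟩).hasDerivWithinAt)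
      (B := fun _ => (0 : ℝ)) (B' := fun _ => 0) (by simpa using hF0) continuousOn_const
      (fun x _ => hasDerivWithinAt_const _ _ _) ?_ (x := -w) ⟨by linarith, le_rfl⟩
    · simpa using this
    intro x hx hFx
    have hx' := hneg x ⟨hx.1, hx.2.le⟩
    set y := -x with hy
    have hk := key y hx' hFx.le
    set p' := -((fp y - A y) * fC y + y * A y * (1 - fp y)) / y
    have hB0 := hBpos y hx'
    have hC0 : 0 < fC y := add_pos hB0 hx'
    have hp1 : fp y < 1 := hk.1.trans (by rw [div_lt_one (by linarith)]; linarith)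
    have hp0 : 0 < fp y := by
      have h1 : (m + 1) * fp y * fC y ^ 2 = 2 * (1 - fp y) * fB y ^ 2 := by
        have : F y = 0 := hFx
        simp only [hF] at this
        linarith
      have h2 : 0 < 2 * (1 - fp y) * fB y ^ 2 := by
        have : 0 < 1 - fp y := by linarith
        positivity
      rw [← h1] at h2
      have h3 := pos_of_mul_pos_left h2 (by positivity)
      exact pos_of_mul_pos_right h3 (by positivity)
    have hp2 : 0 < 1 - fp y := by linarith
    have hp' := hk.2
    rw [smul_eq_mul, neg_one_mul, neg_lt_zero]
    have h1 : 0 < (m + 1) * p' * fC y ^ 2 := by positivity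
    have h2 : 0 < (m + 1) * fp y * (2 * fC y * (1 - fp y)) := by positivity
    have h3 : 0 < 2 * p' * fB y ^ 2 := by positivity
    have h4 : 0 < 2 * (1 - fp y) * (2 * fB y * fp y) := by positivity
    linarith
  have hmono : ∀ w, 0 < w → w ≤ z → fp w ≤ fp z := by
    intro w hw hwz
    have : MonotoneOn fp (Set.Icc w z) := by
      refine monotoneOn_of_deriv_nonneg (convex_Icc w z)
        (fun x hx => (dp x (hw.trans_le hx.1)).continuousAt.continuousWithinAt)
        (fun x hx =>
          (dp x (hw.trans_le (interior_subset hx).1)).differentiableAt.differentiableWithinAt)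
        fun x hx => ?_
      have hx := interior_subset hx
      rw [(dp x (hw.trans_le hx.1)).deriv]
      exact (key x (hw.trans_le hx.1) (hback x (hw.trans_le hx.1) hx.2)).2.le
    exact this ⟨le_rfl, hwz⟩ ⟨hwz, le_rfl⟩ hwz
  have hlt := (key z hz hF0).1
  have hlow : ∀ w, 0 < w → 2 / (m + 3) - 2 / (m + 3) * w ≤ fp w := by
    intro w hw
    have h1 := riccati_le hA hA0 hA1 hw
    have h2 := hA0 w hw
    have h3 : fC w ≤ m + 2 + w := by
      have : 0 < w * A w := by positivity
      simp only [hfC]; linarith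
    have h4 : A w * fC w ≤ 2 / (m + 3) * (m + 2 + w) := by
      have h0 : 0 ≤ fC w := (add_pos (hBpos w hw) hw).le
      gcongr
    have h5 : (2 : ℝ) / (m + 3) * (m + 2) = 2 - 2 / (m + 3) := by
      field_simp
      ring
    simp only [hfp]
    linarith
  set ε := 2 / ((m : ℝ) + 3) - fp z with hε
  have hε0 : 0 < ε := by linarith
  have hc1 : 2 / ((m : ℝ) + 3) ≤ 1 := by rw [div_le_one (by linarith)]; linarith
  have hw : 0 < min z (ε / 2) := lt_min hz (by positivity)
  have h1 := hlow _ hw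
  have h2 := hmono _ hw (min_le_left _ _)
  have h3 : 2 / ((m : ℝ) + 3) * min z (ε / 2) ≤ 1 * (ε / 2) := by
    gcongr
    exact min_le_right _ _
  linarith

end Riccati

/-! ### Weights with two distinct values, the smaller one simple -/

section TwoValues

/-- The commutator of smoothing with multiplication by the variable. On the Laplace side it is
minus the derivative of `1 / (1 + c s)`. -/
lemma id_mul_es_smul (c : ℝ) (g : C(ℝ, ℝ)) :
    ContinuousMap.id ℝ * (es c • g) =
      es c • (ContinuousMap.id ℝ * g) + c • (es c • es c • g) := by
  rcases eq_or_ne c 0 with rfl | hc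
  · simp [es_zero]
  rw [← sub_eq_iff_eq_add]
  refine eq_es_smul hc ?_ fun x => ?_
  · simp [es_smul_apply_zero hc]
  · have h1 := hasDerivAt_es_smul hc g x
    have h2 := hasDerivAt_es_smul hc (es c • g) x
    refine (((hasDerivAt_id x).mul h1).sub (h2.const_mul c)).congr_deriv ?_
    simp only [ds_smul_apply, ContinuousMap.sub_apply, ContinuousMap.mul_apply,
      ContinuousMap.smul_apply, smul_eq_mul, ContinuousMap.id_apply, id]
    field_simp
    ring

lemma id_mul_expDensity {a : ℝ} (ha : a ≠ 0) :
    ContinuousMap.id ℝ * expDensity a = a • (es a • expDensity a) := by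
  have : (a⁻¹ • (ContinuousMap.id ℝ * expDensity a) : C(ℝ, ℝ)) = es a • expDensity a := by
    refine eq_es_smul ha (by simp) fun x => ?_
    refine (((hasDerivAt_id x).mul (hasDerivAt_expDensity a x)).const_mul a⁻¹).congr_deriv ?_
    simp only [ContinuousMap.mul_apply, ContinuousMap.smul_apply, smul_eq_mul,
      ContinuousMap.id_apply, id]
    field_simp
    ring
  rw [← this, smul_smul, mul_inv_cancel₀ ha, one_smul]

lemma id_mul_es_pow_smul (c : ℝ) (n : ℕ) (g : C(ℝ, ℝ)) :
    ContinuousMap.id ℝ * (es c ^ n • g) =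
      es c ^ n • (ContinuousMap.id ℝ * g) + (n * c) • (es c ^ (n + 1) • g) := by
  induction n with
  | zero => simp
  | succ n ih =>
    rw [pow_succ', mul_smul, id_mul_es_smul, ih, smul_add, smul_comm (es c) ((n : ℝ) * c),
      ← mul_smul (es c) (es c ^ n), ← mul_smul (es c) (es c ^ (n + 1)),
      ← mul_smul (es c) (es c ^ n), ← mul_smul (es c) (es c * es c ^ n), ← pow_succ', ← pow_succ',
      add_assoc, ← add_smul]
    push_cast
    ring_nf

lemma id_mul_density {a : ℝ} (ha : a ≠ 0) (b : ℝ) (m k : ℕ) :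
    ContinuousMap.id ℝ * ((es a ^ m * es b ^ k) • expDensity a) =
      ((m + 1) * a) • (es a • (es a ^ m * es b ^ k) • expDensity a) +
        (k * b) • (es b • (es a ^ m * es b ^ k) • expDensity a) := by
  rw [mul_smul, id_mul_es_pow_smul, id_mul_es_pow_smul, id_mul_expDensity ha]
  simp only [smul_add, smul_comm (_ : SmoothAlg) (_ : ℝ), ← mul_smul]
  have h1 : es a ^ m * (es b ^ k * es a) = es a * (es a ^ m * es b ^ k) := by ring
  have h2 : es a ^ m * es b ^ (k + 1) = es b * (es a ^ m * es b ^ k) := by ring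
  have h3 : es a ^ (m + 1) * es b ^ k = es a * (es a ^ m * es b ^ k) := by ring
  rw [h1, h2, h3, add_mul, add_smul, one_mul]
  abel

variable {a b x : ℝ} {m : ℕ}

/-- The solution of the Riccati equation attached to a density `f` with weights `a` and `b`: the
mean share, given the value of the sum, of the part of weight `b`. -/
noncomputable def densityShare (a b : ℝ) (m : ℕ) (x : ℝ) : ℝ :=
  2 * b * (es b • (es a ^ m * es b ^ 2) • expDensity a) x /
    (x * ((es a ^ m * es b ^ 2) • expDensity a) x)

lemma density_mem (hb : 0 < b) (hab : b < a) (i k : ℕ) : es a ^ i * es b ^ k ∈ smoothMonoid :=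
  mul_mem (pow_mem (es_mem (hb.trans hab).le) _) (pow_mem (es_mem hb.le) _)

lemma density_pos (hb : 0 < b) (hab : b < a) (hx : 0 < x) (i k : ℕ) :
    0 < ((es a ^ i * es b ^ k) • expDensity a) x :=
  smul_expDensity_pos (hb.trans hab) (density_mem hb hab i k) hx

lemma es_density_pos (hb : 0 < b) (hab : b < a) (hx : 0 < x) (i k : ℕ) {c : ℝ} (hc : 0 < c) :
    0 < (es c • (es a ^ i * es b ^ k) • expDensity a) x := by
  rw [← mul_smul]
  exact smul_expDensity_pos (hb.trans hab) (mul_mem (es_mem hc.le) (density_mem hb hab i k)) hx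

lemma id_mul_density_apply (hb : 0 < b) (hab : b < a) (x : ℝ) :
    x * ((es a ^ m * es b ^ 2) • expDensity a) x =
      (m + 1) * a * (es a • (es a ^ m * es b ^ 2) • expDensity a) x +
        2 * b * (es b • (es a ^ m * es b ^ 2) • expDensity a) x := by
  have := congrArg (fun g : C(ℝ, ℝ) => g x) (id_mul_density (hb.trans hab).ne' b m 2)
  simpa using this

lemma hasDerivAt_densityShare (hb : 0 < b) (hab : b < a) (hx : 0 < x) :
    HasDerivAt (densityShare a b m) ((2 - (m + 3) * densityShare a b m x) / x
      - (1 / b - 1 / a) * densityShare a b m x * (1 - densityShare a b m x)) x := by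
  have ha := hb.trans hab
  have hid := fun x => id_mul_density_apply (m := m) hb hab x
  have hf := density_pos hb hab hx m 2
  set f := (es a ^ m * es b ^ 2) • expDensity a with hf'
  have hp := hasDerivAt_es_smul ha.ne' f x
  have hr := hasDerivAt_es_smul hb.ne' f x
  rw [ds_smul_apply] at hp hr
  have hxf : 0 < x * f x := by positivity
  have hS : HasDerivAt (fun x => x * f x)
      ((m + 1) * a * ((f x - (es a • f) x) / a) + 2 * b * ((f x - (es b • f) x) / b)) x :=
    ((hp.const_mul _).add (hr.const_mul _)).congr_of_eventuallyEq (.of_forall hid)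
  refine ((hr.const_mul (2 * b)).div hS hxf.ne').congr_deriv ?_
  have hi := hid x
  simp only [densityShare, ← hf']
  have hpe : (es a • f) x = (x * f x - 2 * b * (es b • f) x) / ((m + 1) * a) := by
    rw [eq_div_iff (by positivity), hi]; ring
  rw [hpe]
  field_simp
  ring

lemma densityShare_pos (hb : 0 < b) (hab : b < a) (hx : 0 < x) : 0 < densityShare a b m x := by
  have h1 := density_pos hb hab hx m 2
  have h2 := es_density_pos hb hab hx m 2 hb
  rw [densityShare]
  positivity

/-- The complementary share is positive. -/
lemma densityShare_lt_one (hb : 0 < b) (hab : b < a) (hx : 0 < x) :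
    densityShare a b m x < 1 := by
  have h1 := density_pos hb hab hx m 2
  have h2 := es_density_pos hb hab hx m 2 (hb.trans hab)
  have ha := hb.trans hab
  rw [densityShare, div_lt_one (by positivity), id_mul_density_apply hb hab]
  have : 0 < (m + 1) * a * (es a • (es a ^ m * es b ^ 2) • expDensity a) x := by positivity
  linarith

/-- The bound `z A < 2` needed for the Riccati inequality. -/
lemma mul_densityShare_lt_two (hm : 1 ≤ m) (hb : 0 < b) (hab : b < a) (hx : 0 < x) :
    (1 / b - 1 / a) * x * densityShare a b m x < 2 := by
  have ha := hb.trans hab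
  have h1 := density_pos hb hab hx m 2
  obtain ⟨n, rfl⟩ : ∃ n, m = n + 1 := ⟨m - 1, by omega⟩
  have h3 := density_pos hb hab hx n 3
  have hres : (a - b) • (es b * (es a ^ (n + 1) * es b ^ 2)) =
      a • (es a ^ (n + 1) * es b ^ 2) - b • (es a ^ n * es b ^ 3) := by
    linear_combination (norm := algebra) es a ^ n * es b ^ 2 * es_resolvent a b
  have h := congrArg (fun r : SmoothAlg => (r • expDensity a) x) hres
  simp only [sub_smul (_ : SmoothAlg), smul_assoc (_ : ℝ) (_ : SmoothAlg), mul_smul (es b),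
    ContinuousMap.sub_apply, ContinuousMap.smul_apply, smul_eq_mul] at h
  set f := (es a ^ (n + 1) * es b ^ 2) • expDensity a with hf
  have hlt : (a - b) * (es b • f) x < a * f x := by
    rw [h]
    have : 0 < b * ((es a ^ n * es b ^ 3) • expDensity a) x := by positivity
    linarith
  have : (1 / b - 1 / a) * x * densityShare a b (n + 1) x =
      2 * ((a - b) * (es b • f) x / (a * f x)) := by
    rw [densityShare, ← hf]
    field_simp
  rw [this]
  have : (a - b) * (es b • f) x / (a * f x) < 1 := by
    rw [div_lt_one (by positivity)]; exact hlt
  linarith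

/-- For weights consisting of `m ≥ 1` copies of `a` and one smaller copy of `b`, the second-order
condition for a transfer fails wherever the first-order condition holds. -/
lemma second_neg_of_critical (hm : 1 ≤ m) (hb : 0 < b) (hab : b < a) (hx : 0 < x)
    (h : ((ds a * ds b * (es a ^ m * es b)) • (1 : C(ℝ, ℝ))) x = 0) :
    ((ds a * ds b * (ds a * ds b * (es a ^ m * es b))) • (1 : C(ℝ, ℝ))) x < 0 := by
  have ha := hb.trans hab
  have hγ : 0 < 1 / b - 1 / a := sub_pos.2 (one_div_lt_one_div_of_lt hb hab)
  set γ := 1 / b - 1 / a with hγ'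
  set A : ℝ → ℝ := fun z => densityShare a b m (z / γ) with hA
  have hfpos := density_pos hb hab hx m 2
  have hshare : densityShare a b m x = 2 * b * (es b • (es a ^ m * es b ^ 2) • expDensity a) x /
    (x * ((es a ^ m * es b ^ 2) • expDensity a) x) := rfl
  have hid := fun x => id_mul_density_apply (m := m) hb hab x
  set f := (es a ^ m * es b ^ 2) • expDensity a with hf
  -- the derivative of `f` vanishes at `x`
  have hfd : HasDerivAt f 0 x := by
    have h1 : f = es b • ((es a ^ m * es b) • expDensity a) := by
      rw [hf, ← mul_smul]; congr 1; ring
    have h2 := hasDerivAt_es_smul hb.ne' ((es a ^ m * es b) • expDensity a) x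
    rw [← h1] at h2
    convert h2 using 1
    rw [← h, ← ds_smul_one ha.ne', ← mul_smul, ← mul_smul]
    congr 2; ring
  have hp := hasDerivAt_es_smul ha.ne' f x
  have hr := hasDerivAt_es_smul hb.ne' f x
  rw [ds_smul_apply] at hp hr
  have hcrit : f x = (m + 1) * (f x - (es a • f) x) + 2 * (f x - (es b • f) x) := by
    have hS : HasDerivAt (fun x => x * f x)
        ((m + 1) * a * ((f x - (es a • f) x) / a) + 2 * b * ((f x - (es b • f) x) / b)) x :=
      ((hp.const_mul _).add (hr.const_mul _)).congr_of_eventuallyEq (.of_forall hid)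
    have h2 := ((hasDerivAt_id x).mul hfd).unique hS
    simp only [one_mul, mul_zero, add_zero] at h2
    refine h2.trans ?_
    field_simp
  have hx' := hid x
  have hz : 0 < γ * x := by positivity
  have hAx : A (γ * x) = densityShare a b m x := by
    simp only [hA]; rw [mul_div_cancel_left₀ _ hγ.ne']
  have hB : x / a = m + 2 - γ * x * A (γ * x) := by
    have : x / a = ((m + 1) * (es a • f) x + 2 * b / a * (es b • f) x) / f x := by
      field_simp
      linear_combination hx'
    rw [this, hAx, hshare, hγ']
    field_simp
    linear_combination a * hcrit
  have hC : x / b = x / a + γ * x := by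
    rw [hγ']; ring
  have hp' : 2 * (f x - (es b • f) x) / f x = 2 - A (γ * x) * (x / b) := by
    rw [hAx, hshare]
    field_simp
  have key := riccati_inequality (A := A) hm ?_ ?_ ?_ ?_ hz hB hC hp'
  · have h1 : 1 - 2 * (f x - (es b • f) x) / f x = (m + 1) * (f x - (es a • f) x) / f x := by
      field_simp
      linear_combination hcrit
    rw [h1] at key
    have h2 : b ^ 2 * (f x - (es a • f) x) < a ^ 2 * (f x - (es b • f) x) := by
      have e1 : 2 * ((m + 1) * (f x - (es a • f) x) / f x) * (x / a) ^ 2 =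
          (2 * (m + 1) * x ^ 2 / (f x * a ^ 2 * b ^ 2)) * (b ^ 2 * (f x - (es a • f) x)) := by
        field_simp
      have e2 : (m + 1) * (2 * (f x - (es b • f) x) / f x) * (x / b) ^ 2 =
          (2 * (m + 1) * x ^ 2 / (f x * a ^ 2 * b ^ 2)) * (a ^ 2 * (f x - (es b • f) x)) := by
        field_simp
      rw [e1, e2] at key
      exact lt_of_mul_lt_mul_left key (by positivity)
    -- the third derivative of the density with two more copies of each weight
    have hop : (a ^ 2 * b ^ 2 * (a - b)) •
        (ds a * ds b * (ds a * ds b * (es a ^ m * es b))) =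
        (a * b * (a - b)) • (ds a * ds b * (es a ^ m * es b)) +
        b ^ 2 • ((es a ^ m * es b ^ 2 - es a * (es a ^ m * es b ^ 2)) * ds a)
        - a ^ 2 • ((es a ^ m * es b ^ 2 - es b * (es a ^ m * es b ^ 2)) * ds a) := by
      have k1 := smul_ds ha.ne'
      have k2 := smul_ds hb.ne'
      have k3 := ds_mul_es ha.ne' hb.ne'
      have k4 := es_resolvent a b
      set X := ds a * ds b * (es a ^ m * es b) with hX
      have k5 : a • (es a * X) = (es a ^ m * es b ^ 2 - es a * (es a ^ m * es b ^ 2)) * ds a := by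
        rw [hX]
        linear_combination (norm := algebra) (-a) • (ds a * es a ^ m * es b) * k3
          + ds a * es a ^ m * es b ^ 2 * k1
      have k6 : b • (es b * X) = (es a ^ m * es b ^ 2 - es b * (es a ^ m * es b ^ 2)) * ds a := by
        rw [hX]
        linear_combination (norm := algebra) ds a * es a ^ m * es b ^ 2 * k2
      rw [← k5, ← k6]
      have k7 : (a * b) • (ds a * ds b) = (1 - es a) * (1 - es b) := by
        rw [← k1, ← k2]; algebra
      linear_combination (norm := algebra) ((a * b) * (a - b)) • X * k7 + (a * b) • X * k4
    have e1 : ((es a ^ m * es b ^ 2 - es a * (es a ^ m * es b ^ 2)) * ds a) • (1 : C(ℝ, ℝ)) =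
        f - es a • f := by
      rw [mul_smul, ds_smul_one ha.ne', sub_smul, mul_smul (es a)]
    have e2 : ((es a ^ m * es b ^ 2 - es b * (es a ^ m * es b ^ 2)) * ds a) • (1 : C(ℝ, ℝ)) =
        f - es b • f := by
      rw [mul_smul, ds_smul_one ha.ne', sub_smul, mul_smul (es b)]
    have hev := congrArg (fun r : SmoothAlg => (r • (1 : C(ℝ, ℝ))) x) hop
    rw [smul_assoc, sub_smul, add_smul, smul_assoc, smul_assoc, smul_assoc, e1, e2] at hev
    simp only [ContinuousMap.sub_apply, ContinuousMap.add_apply, ContinuousMap.smul_apply,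
      smul_eq_mul, h] at hev
    have hab' : 0 < a - b := sub_pos.2 hab
    refine neg_of_mul_neg_right ?_ (by positivity : 0 ≤ a ^ 2 * b ^ 2 * (a - b))
    rw [hev]
    linarith
  · intro z hz
    have hd := (hasDerivAt_densityShare (m := m) hb hab (div_pos hz hγ)).scomp z
      ((hasDerivAt_id z).div_const γ)
    refine hd.congr_deriv ?_
    simp only [hA, ← hγ', smul_eq_mul]
    field_simp
  · exact fun z hz => densityShare_pos hb hab (div_pos hz hγ)
  · exact fun z hz => densityShare_lt_one hb hab (div_pos hz hγ)
  · intro z hz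
    have := mul_densityShare_lt_two hm hb hab (div_pos hz hγ)
    rwa [← hγ', mul_div_cancel₀ _ hγ.ne'] at this

end TwoValues

/-! ### Minimizing weights are uniform on their support -/

section Classification

open Finset

variable {t : ℕ} {x : ℝ} {q : Fin t → ℝ}

/-- A minimizer has at most two distinct positive weights. By the resolvent identity, a third one
would make a further smoothing of a critical density critical at the same point. -/
lemma eq_or_eq_of_argmin (hx : 0 < x) (hq : q ∈ argminOn (weightSet t) (smoothCdf x))
    {i j l : Fin t} (hi : 0 < q i) (hj : 0 < q j) (hl : 0 < q l) (hij : q i ≠ q j) :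
    q l = q i ∨ q l = q j := by
  by_contra! hcon
  have h1 := critical_of_argmin hx hq hi hj hij
  have h2 := critical_of_argmin hx hq hi hl hcon.1.symm
  have h3 := critical_mul_pos hi hj hl (smoothProd_mem hq.1.1) hx h1
  have h4 := congrArg (fun r : SmoothAlg => (r • (1 : C(ℝ, ℝ))) x)
    (resolvent_ds (a := q i) hj.ne' hl.ne' (smoothProd q))
  rw [smul_assoc, sub_smul (_ : SmoothAlg), smul_assoc, smul_assoc] at h4
  simp only [ContinuousMap.sub_apply, ContinuousMap.smul_apply, smul_eq_mul, h1, h2, mul_zero,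
    sub_zero, mul_eq_zero, sub_eq_zero] at h4
  exact h4.elim (fun h => hcon.2 h.symm) h3.ne'

/-- The smaller of two distinct positive weights of a minimizer occurs only once: for two copies the
first-order inequality contradicts the resolvent identity. -/
lemma eq_of_argmin_of_lt (hx : 0 < x) (hq : q ∈ argminOn (weightSet t) (smoothCdf x))
    {i j l : Fin t} (hj : 0 < q j) (hij : q j < q i) (hl : q l = q j) : l = j := by
  by_contra hcon
  have hi := hj.trans hij
  have h1 := critical_of_argmin hx hq hj hi hij.ne
  obtain ⟨R, hR, h2, H⟩ := transferOptimal_of_argmin hq hcon (hl ▸ hj) hj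
  have h3 := H.first_nonneg hj hl.ge hx.le hR
  rw [← h2, hl] at h3
  have h4 := critical_mul_pos hj hi hj (smoothProd_mem hq.1.1) hx h1
  have h5 := congrArg (fun r : SmoothAlg => (r • (1 : C(ℝ, ℝ))) x)
    (resolvent_ds (a := q j) hi.ne' hj.ne' (smoothProd q))
  rw [smul_assoc, sub_smul (_ : SmoothAlg), smul_assoc, smul_assoc] at h5
  simp only [ContinuousMap.sub_apply, ContinuousMap.smul_apply, smul_eq_mul, h1, mul_zero,
    zero_sub] at h5
  have := mul_pos (sub_pos.2 hij) h4
  have := mul_nonneg hj.le h3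
  linarith

lemma eq_of_argmin (hx : 0 < x) (hq : q ∈ argminOn (weightSet t) (smoothCdf x))
    {i j : Fin t} (hi : 0 < q i) (hj : 0 < q j) : q i = q j := by
  by_contra hne
  wlog hij : q j < q i generalizing i j
  · exact this hj hi (Ne.symm hne) (lt_of_le_of_ne (not_lt.1 hij) hne)
  set m := #{l ∈ univ.erase j | q l = q i} with hm
  have hprod : smoothProd q = es (q i) ^ m * es (q j) := by
    rw [smoothProd, ← mul_prod_erase univ (fun l => es (q l)) (mem_univ j), mul_comm]
    congr 1
    rw [hm, ← prod_const, prod_filter]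
    refine prod_congr rfl fun l hl => ?_
    split_ifs with h
    · rw [h]
    · have : q l = 0 := by
        by_contra h0
        have hpos := lt_of_le_of_ne (hq.1.1 l) (Ne.symm h0)
        rcases eq_or_eq_of_argmin hx hq hi hj hpos hne with h' | h'
        · exact h h'
        · exact (mem_erase.1 hl).1 (eq_of_argmin_of_lt hx hq hj hij h')
      rw [this, es_zero]
  have hm1 : 1 ≤ m := by
    rw [hm, Nat.one_le_iff_ne_zero, card_ne_zero]
    exact ⟨i, by simpa using fun h : i = j => hne (congrArg q h)⟩
  have hcrit := critical_of_argmin hx hq hi hj hne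
  obtain ⟨R, hR, h2, H⟩ := transferOptimal_of_argmin hq (fun h => hne (congrArg q h)) hi hj
  have h3 := H.second_nonneg hj hij hx.le hR
  rw [← h2, hprod, mul_assoc] at h3
  rw [hprod] at hcrit
  exact absurd (second_neg_of_critical hm1 hj hij hx hcrit) h3.not_gt

lemma sum_uniformWeights {k : ℕ} (hk : k ∈ Set.Icc 1 t) : ∑ i, uniformWeights t k i = 1 := by
  have hk0 : (k : ℝ) ≠ 0 := by have := hk.1; positivity
  have : #{i : Fin t | (i : ℕ) < k} = k := by
    rw [Fin.card_filter_val_lt, min_eq_right hk.2]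
  simp only [uniformWeights]
  rw [← sum_filter, sum_const, this, nsmul_eq_mul, mul_one_div_cancel hk0]

lemma uniformWeights_nonneg (k : ℕ) (i : Fin t) : 0 ≤ uniformWeights t k i := by
  rw [uniformWeights]; positivity

lemma uniformWeights_mem {k : ℕ} (hk : k ∈ Set.Icc 1 t) : uniformWeights t k ∈ weightSet t :=
  ⟨uniformWeights_nonneg k, (sum_uniformWeights hk).le⟩

lemma permutationOrbit_subset {k : ℕ} (hk : k ∈ Set.Icc 1 t) :
    permutationOrbit t k ⊆ weightSet t := by
  rintro _ ⟨σ, rfl⟩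
  exact ⟨fun i => uniformWeights_nonneg k _,
    (Equiv.sum_comp σ (uniformWeights t k)).trans_le (sum_uniformWeights hk).le⟩

lemma smoothCdf_perm (x : ℝ) (q : Fin t → ℝ) (σ : Equiv.Perm (Fin t)) :
    smoothCdf x (fun i => q (σ i)) = smoothCdf x q := by
  rw [smoothCdf, smoothCdf, smoothProd, smoothProd, Equiv.prod_comp σ fun i => es (q i)]

lemma smoothCdf_of_mem_permutationOrbit {k : ℕ} (hq : q ∈ permutationOrbit t k) :
    smoothCdf x q = smoothCdf x (uniformWeights t k) := by
  obtain ⟨σ, rfl⟩ := hq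
  exact smoothCdf_perm x _ σ

/-- Nonnegative weights of sum `1` that are constant on their support are a permutation of uniform
weights. -/
lemma mem_permutationOrbit_of_const (h0 : ∀ i, 0 ≤ q i) (h1 : ∑ i, q i = 1)
    (heq : ∀ i j, 0 < q i → 0 < q j → q i = q j) :
    ∃ k ∈ Set.Icc 1 t, q ∈ permutationOrbit t k := by
  obtain ⟨i₀, hi₀⟩ : ∃ i, 0 < q i := by
    by_contra! h
    have := sum_nonpos fun i (_ : i ∈ univ) => h i
    linarith
  set k := #{i : Fin t | 0 < q i} with hk
  have hk1 : 1 ≤ k := by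
    rw [hk, Nat.one_le_iff_ne_zero, card_ne_zero]
    exact ⟨i₀, by simpa using hi₀⟩
  have hkt : k ≤ t := by simpa using card_filter_le (univ : Finset (Fin t)) fun i => 0 < q i
  have hval : ∀ i, q i = if 0 < q i then 1 / (k : ℝ) else 0 := by
    have hsum : (k : ℝ) * q i₀ = 1 := by
      rw [← h1, hk, ← nsmul_eq_mul, ← sum_const, sum_filter]
      refine sum_congr rfl fun i _ => ?_
      split_ifs with h
      · exact heq i₀ i hi₀ h
      · exact (le_antisymm (not_lt.1 h) (h0 i)).symm
    intro i
    split_ifs with h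
    · have : (k : ℝ) ≠ 0 := by positivity
      rw [heq i i₀ h hi₀, eq_div_iff this, mul_comm, hsum]
    · exact le_antisymm (not_lt.1 h) (h0 i)
  have hcard : Fintype.card {i : Fin t // 0 < q i} = Fintype.card {i : Fin t // (i : ℕ) < k} := by
    rw [Fintype.card_subtype, Fintype.card_subtype, Fin.card_filter_val_lt, min_eq_right hkt]
  set σ := (Fintype.equivOfCardEq hcard).extendSubtype
  refine ⟨k, ⟨hk1, hkt⟩, σ, funext fun i => ?_⟩
  rw [hval i, uniformWeights]
  by_cases h : 0 < q i
  · rw [if_pos h, if_pos ((Fintype.equivOfCardEq hcard).extendSubtype_mem i h)]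
  · rw [if_neg h, if_neg ((Fintype.equivOfCardEq hcard).extendSubtype_not_mem i h)]

/-- The numbers `k` for which the uniform weights on `k` coordinates are optimal. -/
def optimalSizes (t : ℕ) (x : ℝ) : Set ℕ :=
  {k ∈ Set.Icc 1 t | uniformWeights t k ∈ argminOn (weightSet t) (smoothCdf x)}

lemma argminOn_smoothCdf (ht : 1 ≤ t) (hx : 0 < x) :
    argminOn (weightSet t) (smoothCdf x) = ⋃ k ∈ optimalSizes t x, permutationOrbit t k := by
  ext q
  simp only [Set.mem_iUnion, exists_prop]
  constructor
  · intro hq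
    obtain ⟨k, hk, hqk⟩ := mem_permutationOrbit_of_const hq.1.1 (sum_eq_one_of_argmin ht hx hq)
      fun i j => eq_of_argmin hx hq
    refine ⟨k, ⟨hk, uniformWeights_mem hk, fun b hb => ?_⟩, hqk⟩
    rw [← smoothCdf_of_mem_permutationOrbit hqk]
    exact hq.2 b hb
  · rintro ⟨k, ⟨hk, hk'⟩, hqk⟩
    refine ⟨permutationOrbit_subset hk hqk, fun b hb => ?_⟩
    rw [smoothCdf_of_mem_permutationOrbit hqk]
    exact hk'.2 b hb

end Classification

/-! ### Weighted sums of exponential variables -/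

section WeightedSums

open Finset

/-- Adding an independent exponential variable with weight `a` smooths the distribution function. -/
lemma lintegral_expMeasure_eq_es_smul {a : ℝ} (ha : 0 < a) {ν : Measure ℝ} {g : C(ℝ, ℝ)}
    (hg : ∀ y, 0 ≤ y → 0 ≤ g y)
    (hν : ∀ y, ν (Set.Iic y) = if 0 ≤ y then ENNReal.ofReal (g y) else 0) (x : ℝ) :
    ∫⁻ u, ν (Set.Iic (x - a * u)) ∂(expMeasure 1) =
      if 0 ≤ x then ENNReal.ofReal ((es a • g) x) else 0 := by
  have hmeas : Measurable fun u => ν (Set.Iic (x - a * u)) := by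
    simp_rw [hν]
    refine Measurable.ite ?_ (by fun_prop) measurable_const
    exact measurableSet_le measurable_const (by fun_prop)
  have hpdf : Measurable (gammaPDF 1 1) := (measurable_gammaPDFReal 1 1).ennreal_ofReal
  rw [expMeasure, gammaMeasure, lintegral_withDensity_eq_lintegral_mul _ hpdf hmeas]
  have hfun : (gammaPDF 1 1 * fun u => ν (Set.Iic (x - a * u))) =
      (Set.Icc 0 (x / a)).indicator
        (fun u => ENNReal.ofReal (Real.exp (-u) * g (x - a * u))) := by
    ext u
    rw [Pi.mul_apply, hν, Set.indicator_apply]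
    have hiff : u ≤ x / a ↔ 0 ≤ x - a * u := by rw [le_div_iff₀ ha, sub_nonneg, mul_comm]
    rcases lt_or_ge u 0 with hu | hu
    · rw [gammaPDF_of_neg hu, zero_mul, if_neg fun h => hu.not_ge h.1]
    · by_cases h : 0 ≤ x - a * u
      · rw [if_pos h, if_pos ⟨hu, hiff.2 h⟩, gammaPDF_of_nonneg hu,
          ← ENNReal.ofReal_mul (by positivity)]
        simp
      · rw [if_neg h, if_neg fun h' => h (hiff.1 h'.2), mul_zero]
  rw [hfun, lintegral_indicator measurableSet_Icc]
  split_ifs with hx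
  · rw [← ofReal_integral_eq_lintegral_ofReal]
    · congr 1
      rw [integral_Icc_eq_integral_Ioc, ← intervalIntegral.integral_of_le (by positivity),
        es_smul_apply ha.ne']
      have h := intervalIntegral.integral_comp_sub_mul (a := 0) (b := x / a)
        (fun y : ℝ => Real.exp (-((x - y) / a)) * g y) ha.ne' x
      have hcongr : ∀ u, Real.exp (-((x - (x - a * u)) / a)) * g (x - a * u) =
          Real.exp (-u) * g (x - a * u) := fun u => by
        congr 2; field_simp; ring
      simp only [hcongr, mul_zero, sub_zero, mul_div_cancel₀ _ ha.ne', sub_self, smul_eq_mul] at h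
      rw [h, mul_assoc, ← intervalIntegral.integral_const_mul (Real.exp (-x / a))]
      refine congrArg (a⁻¹ * ·) (intervalIntegral.integral_congr fun y _ => ?_)
      rw [← mul_assoc, ← Real.exp_add]
      congr 2; ring
    · exact (Continuous.continuousOn (by fun_prop)).integrableOn_compact isCompact_Icc
    · rw [Filter.EventuallyLE, ae_restrict_iff' measurableSet_Icc]
      refine .of_forall fun u hu => mul_nonneg (Real.exp_pos _).le (hg _ ?_)
      have := (le_div_iff₀ ha).1 hu.2
      linarith
  · rw [Set.Icc_eq_empty (by rw [not_le]; exact div_neg_of_neg_of_pos (not_le.1 hx) ha)]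
    simp

variable {t : ℕ} {Ω : Type*} [MeasurableSpace Ω] {P : Measure Ω} [IsProbabilityMeasure P]
  {X : Fin t → Ω → ℝ}

lemma smul_one_nonneg {r : SmoothAlg} (hr : r ∈ smoothMonoid) {x : ℝ} (hx : 0 ≤ x) :
    0 ≤ (r • (1 : C(ℝ, ℝ))) x := by
  suffices ∀ y, 0 ≤ y → 0 ≤ (r • (1 : C(ℝ, ℝ))) y from this x hx
  refine smoothMonoid_induction (p := fun r => ∀ y, 0 ≤ y → 0 ≤ (r • (1 : C(ℝ, ℝ))) y) ?_ ?_ hr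
  · simp
  · intro a r ha h y hy
    rw [mul_smul]
    exact es_smul_nonneg ha.le hy fun z hz => h z hz.1

lemma measure_sum_le (hX : ∀ i, HasLaw (X i) (expMeasure 1) P) (hind : iIndepFun X P)
    {q : Fin t → ℝ} (hq : ∀ i, 0 ≤ q i) (S : Finset (Fin t)) (x : ℝ) :
    P {ω | ∑ i ∈ S, q i * X i ω ≤ x} =
      if 0 ≤ x then ENNReal.ofReal (((∏ i ∈ S, es (q i)) • (1 : C(ℝ, ℝ))) x) else 0 := by
  induction S using Finset.induction_on generalizing x with
  | empty =>
    by_cases hx : 0 ≤ x <;> simp [hx]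
  | insert j S hj ih =>
    rcases (hq j).eq_or_lt with h0 | h0
    · simpa [sum_insert hj, prod_insert hj, ← h0, es_zero] using ih x
    have hm : ∀ i, AEMeasurable (fun ω => q i * X i ω) P := fun i =>
      (hX i).aemeasurable.const_mul _
    have hY : iIndepFun (fun i ω => q i * X i ω) P :=
      hind.comp (fun i y => q i * y) fun i => measurable_const_mul _
    have hTm : AEMeasurable (fun ω => ∑ i ∈ S, q i * X i ω) P :=
      Finset.aemeasurable_fun_sum _ fun i _ => hm i
    have hT : IndepFun (fun ω => ∑ i ∈ S, q i * X i ω) (fun ω => q j * X j ω) P := by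
      have := hY.indepFun_finsetSum_of_notMem₀ hm hj
      simpa only [← Finset.sum_fn] using this
    set ν := P.map (fun ω => ∑ i ∈ S, q i * X i ω) with hνdef
    have : IsProbabilityMeasure ν := Measure.isProbabilityMeasure_map hTm
    have hν : ∀ y, ν (Set.Iic y) = if 0 ≤ y then
        ENNReal.ofReal (((∏ i ∈ S, es (q i)) • (1 : C(ℝ, ℝ))) y) else 0 := fun y => by
      rw [hνdef, Measure.map_apply_of_aemeasurable hTm measurableSet_Iic, ← ih y]
      rfl
    have hlaw := (indepFun_iff_map_prod_eq_prod_map_map (hm j) hTm).1 hT.symm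
    have hset : MeasurableSet {p : ℝ × ℝ | p.1 + p.2 ≤ x} :=
      measurableSet_le (by fun_prop) measurable_const
    have h1 : P {ω | ∑ i ∈ insert j S, q i * X i ω ≤ x} =
        ((P.map fun ω => q j * X j ω).prod ν) {p : ℝ × ℝ | p.1 + p.2 ≤ x} := by
      rw [← hlaw, Measure.map_apply_of_aemeasurable ((hm j).prodMk hTm) hset]
      simp only [sum_insert hj]
      rfl
    have h2 : P.map (fun ω => q j * X j ω) = (expMeasure 1).map (fun u => q j * u) := by
      rw [← (hX j).map_eq, AEMeasurable.map_map_of_aemeasurable (by fun_prop) (hX j).aemeasurable]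
      rfl
    have := isProbabilityMeasure_expMeasure (r := 1) one_pos
    have h3 : ∀ y : ℝ, Prod.mk y ⁻¹' {p : ℝ × ℝ | p.1 + p.2 ≤ x} = Set.Iic (x - y) := fun y => by
      ext z; simp [le_sub_iff_add_le']
    rw [h1, Measure.prod_apply hset, h2, lintegral_map (measurable_measure_prodMk_left hset)
      (by fun_prop), prod_insert hj, mul_smul]
    simp only [h3]
    exact lintegral_expMeasure_eq_es_smul h0
      (fun y hy => smul_one_nonneg (Submonoid.prod_mem _ fun i _ => es_mem (hq i)) hy) hν x

/-- The distribution function of a weighted sum of independent standard exponential variables. -/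
lemma weightedSumCdf_eq (hX : ∀ i, HasLaw (X i) (expMeasure 1) P) (hind : iIndepFun X P)
    {q : Fin t → ℝ} (hq : ∀ i, 0 ≤ q i) {x : ℝ} (hx : 0 ≤ x) :
    weightedSumCdf P X x q = smoothCdf x q := by
  have h := measure_sum_le hX hind hq univ x
  rw [if_pos hx] at h
  rw [weightedSumCdf, measureReal_def, h, ENNReal.toReal_ofReal]
  · rfl
  · exact smul_one_nonneg (smoothProd_mem hq) hx

/-- A weighted sum of exponential variables has no atom away from `0`. -/
lemma measure_sum_eq (hX : ∀ i, HasLaw (X i) (expMeasure 1) P) (hind : iIndepFun X P)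
    {q : Fin t → ℝ} (hq : ∀ i, 0 ≤ q i) {x : ℝ} (hx : 0 < x) :
    P {ω | ∑ i, q i * X i ω = x} = 0 := by
  have hTm : AEMeasurable (fun ω => ∑ i, q i * X i ω) P :=
    Finset.aemeasurable_fun_sum _ fun i _ => (hX i).aemeasurable.const_mul _
  set g := smoothProd q • (1 : C(ℝ, ℝ)) with hg
  have hle : ∀ᶠ y in nhdsWithin x (Set.Iio x),
      P {ω | ∑ i, q i * X i ω = x} ≤ ENNReal.ofReal (g x) - ENNReal.ofReal (g y) := by
    filter_upwards [Ioo_mem_nhdsLT hx] with y hy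
    have h1 := measure_sum_le hX hind hq univ x
    have h2 := measure_sum_le hX hind hq univ y
    rw [if_pos hx.le] at h1
    rw [if_pos hy.1.le] at h2
    change _ = ENNReal.ofReal (g x) at h1
    change _ = ENNReal.ofReal (g y) at h2
    refine ENNReal.le_sub_of_add_le_right ENNReal.ofReal_ne_top ?_
    rw [← h1, ← h2, ← measure_union₀]
    · refine measure_mono ?_
      rintro ω (h | h)
      · exact (h : _ = x).le
      · exact (h : _ ≤ y).trans hy.2.le
    · exact nullMeasurableSet_le hTm aemeasurable_const
    · refine (Set.disjoint_left.2 ?_).aedisjoint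
      rintro ω (h : _ = x) (h' : _ ≤ y)
      linarith [hy.2]
  have hlim : Filter.Tendsto (fun y => ENNReal.ofReal (g x) - ENNReal.ofReal (g y))
      (nhdsWithin x (Set.Iio x)) (nhds (ENNReal.ofReal (g x) - ENNReal.ofReal (g x))) := by
    refine ENNReal.Tendsto.sub tendsto_const_nhds ?_ (Or.inl ENNReal.ofReal_ne_top)
    have : Continuous fun y => ENNReal.ofReal (g y) := ENNReal.continuous_ofReal.comp g.continuous
    exact (this.tendsto x).mono_left nhdsWithin_le_nhds
  rw [tsub_self] at hlim
  exact le_antisymm (ge_of_tendsto hlim hle) zero_le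

lemma continuousOn_weightedSumCdf (hX : ∀ i, HasLaw (X i) (expMeasure 1) P)
    (hind : iIndepFun X P) {x : ℝ} (hx : 0 < x) :
    ContinuousOn (weightedSumCdf P X x) (weightSet t) := by
  -- a measurable modification makes the events measurable
  set Y : Fin t → Ω → ℝ := fun i => (hX i).aemeasurable.mk (X i) with hY
  have hYm : ∀ i, Measurable (Y i) := fun i => (hX i).aemeasurable.measurable_mk
  have hXY : ∀ᵐ ω ∂P, ∀ i, X i ω = Y i ω :=
    ae_all_iff.2 fun i => (hX i).aemeasurable.ae_eq_mk
  have hcdf : ∀ q, weightedSumCdf P X x q = (P {ω | ∑ i, q i * Y i ω ≤ x}).toReal := fun q => by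
    rw [weightedSumCdf, measureReal_def]
    congr 1
    refine measure_congr (Filter.eventuallyEq_set.2 ?_)
    filter_upwards [hXY] with ω hω
    simp only [hω]
  intro q hq
  have hlim : Filter.Tendsto (fun q' => P {ω | ∑ i, q' i * Y i ω ≤ x})
      (nhdsWithin q (weightSet t)) (nhds (P {ω | ∑ i, q i * Y i ω ≤ x})) := by
    refine tendsto_measure_of_ae_tendsto_indicator_of_isFiniteMeasure _
      (measurableSet_le (by fun_prop) measurable_const)
      (fun q' => measurableSet_le (by fun_prop) measurable_const) ?_
    have h0 : ∀ᵐ ω ∂P, ∑ i, q i * X i ω ≠ x := by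
      rw [ae_iff]
      simpa using measure_sum_eq hX hind hq.1 hx
    filter_upwards [hXY, h0] with ω hω h0
    simp only [hω] at h0
    have hc : Filter.Tendsto (fun q' : Fin t → ℝ => ∑ i, q' i * Y i ω)
        (nhdsWithin q (weightSet t)) (nhds (∑ i, q i * Y i ω)) := by
      have : Continuous fun q' : Fin t → ℝ => ∑ i, q' i * Y i ω := by fun_prop
      exact (this.tendsto q).mono_left nhdsWithin_le_nhds
    rcases lt_or_gt_of_ne h0 with h | h
    · filter_upwards [hc.eventually (gt_mem_nhds h)] with q' hq'
      exact iff_of_true hq'.le h.le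
    · filter_upwards [hc.eventually (lt_mem_nhds h)] with q' hq'
      exact iff_of_false (not_le.2 hq') (not_le.2 h)
  rw [funext hcdf]
  exact (ENNReal.tendsto_toReal (measure_ne_top _ _)).comp hlim

lemma isCompact_weightSet (t : ℕ) : IsCompact (weightSet t) := by
  have hsub : weightSet t ⊆ Set.Icc 0 1 := fun q hq =>
    ⟨fun i => hq.1 i, fun i => (single_le_sum (fun j _ => hq.1 j) (mem_univ i)).trans hq.2⟩
  refine isCompact_Icc.of_isClosed_subset ?_ hsub
  have h1 : IsClosed {q : Fin t → ℝ | ∀ i, 0 ≤ q i} := by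
    simp only [Set.ofPred_forall]
    exact isClosed_iInter fun i => isClosed_le continuous_const (continuous_apply i)
  exact h1.inter (isClosed_le (continuous_finsetSum _ fun i _ => continuous_apply i)
    continuous_const)

lemma argminOn_congr {α : Type*} {S : Set α} {f g : α → ℝ} (h : ∀ a ∈ S, f a = g a) :
    argminOn S f = argminOn S g := by
  ext a
  refine and_congr_right fun ha => forall₂_congr fun b hb => ?_
  rw [h a ha, h b hb]

lemma argminOn_weightedSumCdf (hX : ∀ i, HasLaw (X i) (expMeasure 1) P) (hind : iIndepFun X P)
    {x : ℝ} (hx : 0 < x) :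
    argminOn (weightSet t) (weightedSumCdf P X x) = argminOn (weightSet t) (smoothCdf x) :=
  argminOn_congr fun _ hq => weightedSumCdf_eq hX hind hq.1 hx.le

lemma optimalSizes_nonempty (ht : 1 ≤ t) (hX : ∀ i, HasLaw (X i) (expMeasure 1) P)
    (hind : iIndepFun X P) {x : ℝ} (hx : 0 < x) : (optimalSizes t x).Nonempty := by
  obtain ⟨q, hq, hmin⟩ := (isCompact_weightSet t).exists_isMinOn ⟨0, by simp [weightSet]⟩
    (continuousOn_weightedSumCdf hX hind hx)
  have : q ∈ argminOn (weightSet t) (weightedSumCdf P X x) := ⟨hq, fun b hb => hmin hb⟩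
  rw [argminOn_weightedSumCdf hX hind hx, argminOn_smoothCdf ht hx] at this
  obtain ⟨k, hk, -⟩ := Set.mem_iUnion₂.1 this
  exact ⟨k, hk⟩

end WeightedSums

/-! ### Coincidences between uniform weights -/

section Coincidences

open Finset

/-- By Rolle's theorem, a function whose derivative has finitely many zeros has finitely many
zeros. -/
lemma finite_zeros_of_deriv {f f' : ℝ → ℝ} (hf : ∀ x, 0 < x → HasDerivAt f (f' x) x)
    (h : {x | 0 < x ∧ f' x = 0}.Finite) : {x | 0 < x ∧ f x = 0}.Finite := by
  by_contra hinf
  obtain ⟨s, hs, hcard⟩ := Set.Infinite.exists_subset_card_eq hinf (#h.toFinset + 2)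
  set e := s.orderEmbOfFin hcard with he
  have hz : ∀ i, 0 < e i ∧ f (e i) = 0 := fun i => hs (s.orderEmbOfFin_mem hcard i)
  have hex : ∀ i : Fin (#h.toFinset + 1),
      ∃ c ∈ Set.Ioo (e i.castSucc) (e i.succ), f' c = 0 := fun i => by
    refine exists_hasDerivAt_eq_zero (f := f) (e.strictMono Fin.castSucc_lt_succ) ?_ ?_ ?_
    · exact fun x hx => (hf x ((hz _).1.trans_le hx.1)).continuousAt.continuousWithinAt
    · rw [(hz _).2, (hz _).2]
    · exact fun x hx => hf x ((hz _).1.trans hx.1)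
  choose c hc hc0 using hex
  have hmono : StrictMono c := by
    refine Fin.strictMono_iff_lt_succ.2 fun i => ?_
    have h1 := (hc i.castSucc).2
    have h2 := (hc i.succ).1
    rw [Fin.succ_castSucc] at h1
    exact h1.trans h2
  have hle := card_le_card_of_injOn (s := (univ : Finset (Fin (#h.toFinset + 1))))
    (t := h.toFinset) c
    (fun i _ => by simpa using ⟨(hz _).1.trans (hc i).1, hc0 i⟩) hmono.injective.injOn
  simp at hle

lemma es_pow_smul_expDensity_apply {c : ℝ} (hc : c ≠ 0) (n : ℕ) (x : ℝ) :
    (es c ^ n • expDensity c) x = x ^ n * Real.exp (-x / c) / (c ^ (n + 1) * n.factorial) := by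
  induction n generalizing x with
  | zero => simp [expDensity_apply]; ring
  | succ n ih =>
    set u : C(ℝ, ℝ) := ⟨fun x => x ^ (n + 1) * Real.exp (-x / c) /
      (c ^ (n + 2) * (n + 1).factorial), by fun_prop⟩ with hu
    have : u = es c • es c ^ n • expDensity c := by
      refine eq_es_smul hc (by simp [hu]) fun x => ?_
      have h := (((hasDerivAt_pow (n + 1) x).mul
        ((hasDerivAt_id x).neg.div_const c).exp).div_const (c ^ (n + 2) * (n + 1).factorial))
      refine h.congr_deriv ?_
      simp only [ih, hu, ContinuousMap.coe_mk, id, Nat.factorial_succ, Nat.add_sub_cancel,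
        Pi.neg_apply]
      push_cast
      have : ((n : ℝ) + 1) ≠ 0 := by positivity
      have : (n.factorial : ℝ) ≠ 0 := by positivity
      field_simp
      ring
    rw [pow_succ', mul_smul, ← this]
    rfl

variable {t : ℕ}

lemma smoothCdf_uniformWeights {k : ℕ} (hk : k ∈ Set.Icc 1 t) (x : ℝ) :
    smoothCdf x (uniformWeights t k) = (es (1 / k) ^ k • (1 : C(ℝ, ℝ))) x := by
  have : smoothProd (uniformWeights t k) = es (1 / k) ^ k := by
    have hcard : #{i : Fin t | (i : ℕ) < k} = k := by
      rw [Fin.card_filter_val_lt, min_eq_right hk.2]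
    conv_rhs => rw [← hcard]
    rw [smoothProd, ← prod_const, prod_filter]
    refine prod_congr rfl fun i _ => ?_
    rw [uniformWeights]
    split_ifs
    · rw [hcard]
    · exact es_zero
  rw [smoothCdf, this]

lemma hasDerivAt_smoothCdf_uniformWeights {k : ℕ} (hk : k ∈ Set.Icc 1 t) (x : ℝ) :
    HasDerivAt (fun x => smoothCdf x (uniformWeights t k))
      (k ^ k / (k - 1).factorial * (x ^ (k - 1) * Real.exp (-(k * x)))) x := by
  obtain ⟨n, rfl⟩ : ∃ n, k = n + 1 := ⟨k - 1, by have := hk.1; omega⟩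
  have hc : (1 / ((n + 1 : ℕ) : ℝ)) ≠ 0 := by positivity
  have h := hasDerivAt_es_smul hc (es (1 / ((n + 1 : ℕ) : ℝ)) ^ n • (1 : C(ℝ, ℝ))) x
  rw [← mul_smul, ← mul_smul, ← pow_succ', mul_comm, mul_smul, ds_smul_one hc,
    es_pow_smul_expDensity_apply hc] at h
  rw [funext (smoothCdf_uniformWeights hk)]
  refine h.congr_deriv ?_
  rw [Nat.add_sub_cancel]
  have : -x / (1 / ((n + 1 : ℕ) : ℝ)) = -((n + 1 : ℕ) * x) := by field_simp
  rw [this, one_div, inv_pow]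
  field_simp

lemma finite_coincidence {k l : ℕ} (hk : k ∈ Set.Icc 1 t) (hl : l ∈ Set.Icc 1 t) (hkl : k < l) :
    {x | 0 < x ∧
      smoothCdf x (uniformWeights t k) - smoothCdf x (uniformWeights t l) = 0}.Finite := by
  refine finite_zeros_of_deriv (fun x _ => (hasDerivAt_smoothCdf_uniformWeights hk x).sub
    (hasDerivAt_smoothCdf_uniformWeights hl x)) ?_
  have hk0 : (0 : ℝ) < k := by have := hk.1; positivity
  have hl0 : (0 : ℝ) < l := by have := hl.1; positivity
  set ck : ℝ := k ^ k / (k - 1).factorial with hck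
  set cl : ℝ := l ^ l / (l - 1).factorial with hcl
  have hck0 : 0 < ck := by positivity
  have hcl0 : 0 < cl := by positivity
  have hkl' : (k : ℝ) < l := by exact_mod_cast hkl
  -- on a logarithmic scale the derivative is `(l - k) (log x - x)` up to a constant
  refine (finite_zeros_of_deriv (f := fun x => (Real.log cl - Real.log ck) +
    (l - k) * (Real.log x - x)) (f' := fun x => (l - k) * (x⁻¹ - 1)) (fun x hx => ?_) ?_).subset ?_
  · exact (((Real.hasDerivAt_log hx.ne').sub (hasDerivAt_id x)).const_mul _).const_add _
  · refine (Set.finite_singleton (1 : ℝ)).subset ?_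
    rintro x ⟨hx, h⟩
    rcases mul_eq_zero.1 h with h | h
    · linarith
    · rw [sub_eq_zero, inv_eq_one] at h
      exact h
  · rintro x ⟨hx, h⟩
    refine ⟨hx, ?_⟩
    rw [sub_eq_zero] at h
    have h1 := congrArg Real.log h
    rw [Real.log_mul hck0.ne' (by positivity), Real.log_mul hcl0.ne' (by positivity),
      Real.log_mul (by positivity) (Real.exp_pos _).ne',
      Real.log_mul (by positivity) (Real.exp_pos _).ne', Real.log_exp, Real.log_exp, Real.log_pow,
      Real.log_pow, Nat.cast_sub hk.1, Nat.cast_sub hl.1] at h1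
    push_cast at h1
    linarith

/-- The thresholds at which two different uniform weight vectors give the same probability. -/
def coincidences (t : ℕ) : Set ℝ :=
  {x | 0 < x ∧ ∃ k ∈ Set.Icc 1 t, ∃ l ∈ Set.Icc 1 t, k < l ∧
    smoothCdf x (uniformWeights t k) = smoothCdf x (uniformWeights t l)}

lemma finite_coincidences (t : ℕ) : (coincidences t).Finite := by
  have : coincidences t ⊆ ⋃ k ∈ Set.Icc 1 t, ⋃ l ∈ Set.Icc 1 t, ⋃ _ : k ∈ Set.Icc 1 t,
      ⋃ _ : l ∈ Set.Icc 1 t, ⋃ _ : k < l,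
      {x | 0 < x ∧ smoothCdf x (uniformWeights t k) - smoothCdf x (uniformWeights t l) = 0} := by
    rintro x ⟨hx, k, hk, l, hl, hkl, h⟩
    simp only [Set.mem_iUnion]
    exact ⟨k, hk, l, hl, hk, hl, hkl, hx, sub_eq_zero.2 h⟩
  refine Set.Finite.subset ?_ this
  refine (Set.finite_Icc 1 t).biUnion fun k _ => (Set.finite_Icc 1 t).biUnion fun l _ => ?_
  exact Set.finite_iUnion fun hk => Set.finite_iUnion fun hl => Set.finite_iUnion fun hkl =>
    finite_coincidence hk hl hkl

lemma optimalSizes_eq_singleton {x : ℝ} (hx : 0 < x) (hE : x ∉ coincidences t)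
    (hne : (optimalSizes t x).Nonempty) : ∃ k ∈ Set.Icc 1 t, optimalSizes t x = {k} := by
  obtain ⟨k, hk⟩ := hne
  refine ⟨k, hk.1, Set.eq_singleton_iff_unique_mem.2 ⟨hk, fun l hl => ?_⟩⟩
  have heq : smoothCdf x (uniformWeights t k) = smoothCdf x (uniformWeights t l) :=
    le_antisymm (hk.2.2 _ hl.2.1) (hl.2.2 _ hk.2.1)
  by_contra hlk
  rcases lt_or_gt_of_ne hlk with h | h
  · exact hE ⟨hx, l, hl.1, k, hk.1, h, heq.symm⟩
  · exact hE ⟨hx, k, hk.1, l, hl.1, h, heq⟩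

end Coincidences

/-! ### Complex Gaussian vectors -/

section Gaussian

lemma measurable_complex_mk : Measurable fun p : ℝ × ℝ => (⟨p.1, p.2⟩ : ℂ) :=
  Complex.measurableEquivRealProd.symm.measurable

instance : IsProbabilityMeasure stdComplexGaussian :=
  Measure.isProbabilityMeasure_map measurable_complex_mk.aemeasurable

lemma gaussianPDF_mul_gaussianPDF (p : ℝ × ℝ) :
    gaussianPDF 0 (1 / 2) p.1 * gaussianPDF 0 (1 / 2) p.2 =
      ENNReal.ofReal (Real.pi⁻¹ * Real.exp (-(p.1 ^ 2 + p.2 ^ 2))) := by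
  rw [gaussianPDF, gaussianPDF, ← ENNReal.ofReal_mul (gaussianPDFReal_nonneg _ _ _)]
  congr 1
  simp only [gaussianPDFReal, sub_zero]
  have h : 2 * Real.pi * ((1 / 2 : NNReal) : ℝ) = Real.pi := by
    push_cast; ring
  have h2 : 2 * ((1 / 2 : NNReal) : ℝ) = 1 := by push_cast; ring
  rw [h, h2, div_one, div_one, mul_mul_mul_comm, ← mul_inv, Real.mul_self_sqrt Real.pi_pos.le,
    ← Real.exp_add]
  congr 2
  ring

/-- The squared modulus of a standard complex Gaussian variable is a standard exponential
variable. -/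
lemma map_normSq_stdComplexGaussian :
    stdComplexGaussian.map (fun z => Complex.normSq z) = expMeasure 1 := by
  have hns : Measurable fun z : ℂ => Complex.normSq z := Complex.continuous_normSq.measurable
  classical
  ext s hs
  rw [Measure.map_apply hns hs, stdComplexGaussian,
    Measure.map_apply measurable_complex_mk (hns hs), gaussianReal_of_var_ne_zero _ (by simp),
    prod_withDensity (measurable_gaussianPDF _ _) (measurable_gaussianPDF _ _),
    ← Measure.volume_eq_prod,
    withDensity_apply _ (measurable_complex_mk (hns hs)), ← lintegral_indicator
      (measurable_complex_mk (hns hs)), ← lintegral_comp_polarCoord_symm]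
  -- in polar coordinates the angle integrates to `2 π`
  set F : ℝ → ENNReal := s.indicator fun u => ENNReal.ofReal (Real.exp (-u)) with hF
  have hFm : Measurable F :=
    (Measurable.ennreal_ofReal (by fun_prop)).indicator hs
  have hint : ∀ p ∈ polarCoord.target, ENNReal.ofReal p.1 •
      ((fun p : ℝ × ℝ => (⟨p.1, p.2⟩ : ℂ)) ⁻¹' ((fun z => Complex.normSq z) ⁻¹' s)).indicator
        (fun p => gaussianPDF 0 (1 / 2) p.1 * gaussianPDF 0 (1 / 2) p.2) (polarCoord.symm p) =
      ENNReal.ofReal (Real.pi⁻¹ * p.1) * F (p.1 ^ 2) := by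
    intro p hp
    have hp1 : 0 < p.1 := hp.1
    have hsq : (p.1 * Real.cos p.2) ^ 2 + (p.1 * Real.sin p.2) ^ 2 = p.1 ^ 2 := by
      linear_combination p.1 ^ 2 * Real.cos_sq_add_sin_sq p.2
    simp only [Set.indicator_apply, Set.mem_preimage, Complex.normSq_mk, hF,
      gaussianPDF_mul_gaussianPDF, polarCoord_symm_apply, ← pow_two, hsq]
    split_ifs
    · rw [smul_eq_mul, ← ENNReal.ofReal_mul hp1.le, ← ENNReal.ofReal_mul (by positivity)]
      congr 1; ring
    · simp
  rw [setLIntegral_congr_fun polarCoord.open_target.measurableSet hint]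
  have hprod : polarCoord.target = Set.Ioi (0 : ℝ) ×ˢ Set.Ioo (-Real.pi) Real.pi := rfl
  rw [hprod, Measure.volume_eq_prod, ← Measure.prod_restrict,
    lintegral_prod _ (by fun_prop)]
  simp only [lintegral_const, Measure.restrict_apply MeasurableSet.univ, Set.univ_inter,
    Real.volume_Ioo]
  have hrad : ∀ r ∈ Set.Ioi (0 : ℝ), ENNReal.ofReal (Real.pi⁻¹ * r) * F (r ^ 2) *
      ENNReal.ofReal (Real.pi - -Real.pi) = ENNReal.ofReal |2 * r| * F (r ^ 2) := by
    intro r (hr : 0 < r)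
    rw [mul_right_comm, ← ENNReal.ofReal_mul (by positivity), abs_of_pos (by positivity)]
    congr 2
    field_simp
    ring
  rw [setLIntegral_congr_fun measurableSet_Ioi hrad]
  have himg : (fun r : ℝ => r ^ 2) '' Set.Ioi 0 = Set.Ioi 0 := by
    ext u
    constructor
    · rintro ⟨r, hr, rfl⟩
      exact pow_pos (Set.mem_Ioi.1 hr) 2
    · intro hu
      exact ⟨Real.sqrt u, Real.sqrt_pos.2 hu, Real.sq_sqrt (le_of_lt hu)⟩
  have hcv := lintegral_image_eq_lintegral_abs_deriv_mul (s := Set.Ioi (0 : ℝ))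
    (f := fun r : ℝ => r ^ 2) (f' := fun r => 2 * r) measurableSet_Ioi
    (fun r _ => by simpa using (hasDerivAt_pow 2 r).hasDerivWithinAt)
    (fun r hr r' hr' h => (pow_left_inj₀ (le_of_lt hr) (le_of_lt hr') two_ne_zero).1 h) F
  rw [← hcv, himg, expMeasure, gammaMeasure, withDensity_apply _ hs, ← lintegral_indicator hs,
    ← lintegral_indicator measurableSet_Ioi]
  refine lintegral_congr_ae ?_
  have h0 : ∀ᵐ u : ℝ, u ≠ 0 := by simp [ae_iff]
  filter_upwards [h0] with u hu
  simp only [Set.indicator_apply, hF, Set.mem_Ioi]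
  rcases lt_or_gt_of_ne hu with hu | hu
  · rw [if_neg hu.not_gt, gammaPDF_of_neg hu, ite_self]
  · rw [if_pos hu, gammaPDF_of_nonneg hu.le]
    simp

lemma charFun_stdComplexGaussian (z : ℂ) :
    charFun stdComplexGaussian z = Complex.exp (-(Complex.normSq z : ℂ) / 4) := by
  have hinner : ∀ p : ℝ × ℝ, Complex.exp ((inner ℝ (⟨p.1, p.2⟩ : ℂ) z : ℝ) * Complex.I) =
      Complex.exp (z.re * p.1 * Complex.I) * Complex.exp (z.im * p.2 * Complex.I) := fun p => by
    rw [← Complex.exp_add, Complex.inner]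
    congr 1
    simp
    ring
  rw [charFun_apply, stdComplexGaussian, integral_map measurable_complex_mk.aemeasurable
    (by fun_prop)]
  simp only [hinner]
  rw [integral_prod_mul (fun x : ℝ => Complex.exp (z.re * x * Complex.I))
    (fun x : ℝ => Complex.exp (z.im * x * Complex.I)), ← charFun_apply_real, ← charFun_apply_real,
    charFun_gaussianReal, charFun_gaussianReal, ← Complex.exp_add]
  congr 1
  rw [Complex.normSq_apply]
  push_cast
  ring

variable {t : ℕ}

lemma sum_normSq_conj_mulVec {U : Matrix (Fin t) (Fin t) ℂ}
    (hU : U ∈ Matrix.unitaryGroup (Fin t) ℂ) (s : Fin t → ℂ) :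
    ∑ i, Complex.normSq (∑ l, star (U i l) * s l) = ∑ l, Complex.normSq (s l) := by
  have hVV : (U.map star).conjTranspose * U.map star = 1 := by
    refine Matrix.ext fun i j => ?_
    have h := congrFun₂ (Matrix.mem_unitaryGroup_iff'.1 hU) j i
    rw [Matrix.mul_apply, Matrix.one_apply] at h
    rw [Matrix.mul_apply, Matrix.one_apply]
    simp only [eq_comm (a := i), ← h]
    refine Finset.sum_congr rfl fun l _ => ?_
    simp [mul_comm]
  have hns : ∀ v : Fin t → ℂ, star v ⬝ᵥ v = ((∑ i, Complex.normSq (v i) : ℝ) : ℂ) := fun v => by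
    simp [dotProduct, Complex.normSq_eq_conj_mul_self]
  have key : star ((U.map star).mulVec s) ⬝ᵥ (U.map star).mulVec s = star s ⬝ᵥ s := by
    rw [Matrix.star_mulVec, ← Matrix.dotProduct_mulVec, Matrix.mulVec_mulVec, hVV,
      Matrix.one_mulVec]
  rw [hns, hns] at key
  exact_mod_cast key

/-- The law of a vector of independent standard complex Gaussian variables is invariant under
unitary matrices, here acting on row vectors. -/
lemma map_vecMul_pi_stdComplexGaussian {U : Matrix (Fin t) (Fin t) ℂ}
    (hU : U ∈ Matrix.unitaryGroup (Fin t) ℂ) :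
    (Measure.pi fun _ : Fin t => stdComplexGaussian).map (fun h l => ∑ i, h i * U i l) =
      Measure.pi fun _ => stdComplexGaussian := by
  have hm : Measurable fun (h : Fin t → ℂ) l => ∑ i, h i * U i l := by fun_prop
  have : IsProbabilityMeasure ((Measure.pi fun _ : Fin t => stdComplexGaussian).map
    (fun h l => ∑ i, h i * U i l)) := Measure.isProbabilityMeasure_map hm.aemeasurable
  refine charFun_eq_pi_iff.1 fun s => ?_
  set g : Fin t → ℂ := fun i => ∑ l, star (U i l) * s l with hg
  have h1 : charFun (((Measure.pi fun _ : Fin t => stdComplexGaussian).map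
      (fun h l => ∑ i, h i * U i l)).map (WithLp.toLp 2)) s =
      charFun ((Measure.pi fun _ : Fin t => stdComplexGaussian).map (WithLp.toLp 2))
        (WithLp.toLp 2 g) := by
    have hc : Continuous (WithLp.toLp 2 : (Fin t → ℂ) → PiLp 2 fun _ : Fin t => ℂ) :=
      PiLp.continuous_toLp 2 _
    rw [charFun_apply, charFun_apply, Measure.map_map hc.measurable hm,
      integral_map (hc.measurable.comp hm).aemeasurable (by fun_prop),
      integral_map hc.aemeasurable (by fun_prop)]
    refine integral_congr_ae (.of_forall fun h => ?_)
    simp only [Function.comp_apply, PiLp.inner_apply]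
    congr 3
    simp only [Complex.inner, hg, ← Complex.re_sum]
    congr 1
    simp only [map_sum, map_mul, Finset.sum_mul, Finset.mul_sum]
    rw [Finset.sum_comm]
    refine Finset.sum_congr rfl fun i _ => Finset.sum_congr rfl fun l _ => ?_
    simp only [Complex.star_def]
    ring
  rw [h1, charFun_pi]
  simp only [charFun_stdComplexGaussian, ← Complex.exp_sum]
  congr 1
  have h2 := sum_normSq_conj_mulVec hU (fun l => s l)
  simp only [← Finset.sum_div, Finset.sum_neg_distrib]
  exact_mod_cast congrArg (fun r : ℝ => -(r : ℂ) / 4) h2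

variable {Ω : Type*} [MeasurableSpace Ω] {P : Measure Ω} [IsProbabilityMeasure P]
  {H : Fin t → Ω → ℂ}

/-- The squared moduli of the coordinates of a complex Gaussian row vector in any orthonormal
frame are independent standard exponential variables. -/
lemma normSq_vecMul_exponential (hH : ∀ i, HasLaw (H i) stdComplexGaussian P)
    (hind : iIndepFun H P) {U : Matrix (Fin t) (Fin t) ℂ}
    (hU : U ∈ Matrix.unitaryGroup (Fin t) ℂ) :
    (∀ l, HasLaw (fun ω => Complex.normSq (∑ i, H i ω * U i l)) (expMeasure 1) P) ∧
      iIndepFun (fun l ω => Complex.normSq (∑ i, H i ω * U i l)) P := by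
  have hns : Measurable fun z : ℂ => Complex.normSq z := Complex.continuous_normSq.measurable
  have hHm : ∀ i, AEMeasurable (H i) P := fun i => (hH i).aemeasurable
  have hWm : ∀ l, AEMeasurable (fun ω => ∑ i, H i ω * U i l) P := fun l =>
    Finset.aemeasurable_fun_sum _ fun i _ => (hHm i).mul_const _
  have hvec : AEMeasurable (fun ω i => H i ω) P := aemeasurable_pi_lambda _ hHm
  have hlawH := (iIndepFun_iff_map_fun_eq_pi_map hHm).1 hind
  simp only [(hH _).map_eq] at hlawH
  have hlawW : P.map (fun ω l => ∑ i, H i ω * U i l) = Measure.pi fun _ => stdComplexGaussian := by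
    rw [← map_vecMul_pi_stdComplexGaussian hU, ← hlawH,
      AEMeasurable.map_map_of_aemeasurable (Measurable.aemeasurable (by fun_prop)) hvec]
    rfl
  have hlaw : ∀ l, P.map (fun ω => ∑ i, H i ω * U i l) = stdComplexGaussian := fun l => by
    have h := (measurePreserving_eval (fun _ : Fin t => stdComplexGaussian) l).map_eq
    rw [← hlawW, AEMeasurable.map_map_of_aemeasurable
      (Measurable.aemeasurable (measurable_pi_apply l)) (aemeasurable_pi_lambda _ hWm)] at h
    exact h
  have hindW : iIndepFun (fun l ω => ∑ i, H i ω * U i l) P := by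
    rw [iIndepFun_iff_map_fun_eq_pi_map hWm, hlawW]
    simp only [hlaw]
  refine ⟨fun l => ⟨hns.comp_aemeasurable (hWm l), ?_⟩, hindW.comp _ fun _ => hns⟩
  rw [← map_normSq_stdComplexGaussian, ← hlaw l,
    AEMeasurable.map_map_of_aemeasurable hns.aemeasurable (hWm l)]
  rfl

end Gaussian

/-! ### The outage problem -/

section Outage

open Finset

variable {t : ℕ}

/-- The matrix `U diag(q) U*`. -/
def conjDiagonal (U : Matrix (Fin t) (Fin t) ℂ) (q : Fin t → ℝ) : Matrix (Fin t) (Fin t) ℂ :=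
  U * Matrix.diagonal (fun i => (q i : ℂ)) * star U

lemma conjDiagonal_apply (U : Matrix (Fin t) (Fin t) ℂ) (q : Fin t → ℝ) (i j : Fin t) :
    conjDiagonal U q i j = ∑ l, U i l * q l * star (U j l) := by
  rw [conjDiagonal, Matrix.mul_apply]
  simp [Matrix.mul_diagonal, Matrix.star_apply]

lemma trace_conjDiagonal {U : Matrix (Fin t) (Fin t) ℂ} (hU : U ∈ Matrix.unitaryGroup (Fin t) ℂ)
    (q : Fin t → ℝ) : (conjDiagonal U q).trace = ((∑ i, q i : ℝ) : ℂ) := by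
  rw [conjDiagonal, Matrix.trace_mul_cycle, Matrix.mem_unitaryGroup_iff'.1 hU, one_mul,
    Matrix.trace_diagonal]
  push_cast
  rfl

lemma conjDiagonal_mem {U : Matrix (Fin t) (Fin t) ℂ} (hU : U ∈ Matrix.unitaryGroup (Fin t) ℂ)
    {q : Fin t → ℝ} (hq : q ∈ weightSet t) : conjDiagonal U q ∈ covarianceSet t := by
  refine ⟨?_, ?_⟩
  · refine Matrix.PosSemidef.mul_mul_conjTranspose_same ?_ U
    exact Matrix.PosSemidef.diagonal fun i =>
      show (0 : ℂ) ≤ (q i : ℂ) by exact_mod_cast hq.1 i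
  · rw [trace_conjDiagonal hU, Complex.ofReal_re]
    exact hq.2

lemma exists_eq_conjDiagonal {Q : Matrix (Fin t) (Fin t) ℂ} (hQ : Q ∈ covarianceSet t) :
    ∃ U ∈ Matrix.unitaryGroup (Fin t) ℂ, ∃ q ∈ weightSet t, Q = conjDiagonal U q := by
  have hH := hQ.1.isHermitian
  have hspec : Q = conjDiagonal hH.eigenvectorUnitary hH.eigenvalues := by
    conv_lhs => rw [hH.spectral_theorem, Unitary.conjStarAlgAut_apply]
    rfl
  refine ⟨_, hH.eigenvectorUnitary.2, hH.eigenvalues, ⟨hQ.1.eigenvalues_nonneg, ?_⟩, hspec⟩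
  have h := trace_conjDiagonal hH.eigenvectorUnitary.2 hH.eigenvalues
  rw [← hspec] at h
  have h2 := hQ.2
  rw [h, Complex.ofReal_re] at h2
  exact h2

/-- Permuting the weights amounts to permuting the columns of the unitary matrix. -/
lemma conjDiagonal_perm {U : Matrix (Fin t) (Fin t) ℂ} (hU : U ∈ Matrix.unitaryGroup (Fin t) ℂ)
    (q : Fin t → ℝ) (σ : Equiv.Perm (Fin t)) :
    ∃ V ∈ Matrix.unitaryGroup (Fin t) ℂ, conjDiagonal U (fun i => q (σ i)) = conjDiagonal V q := by
  refine ⟨U.submatrix id σ.symm, ?_, ?_⟩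
  · refine Matrix.mem_unitaryGroup_iff.2 (Matrix.ext fun i j => ?_)
    have h := congrFun₂ (Matrix.mem_unitaryGroup_iff.1 hU) i j
    rw [← h, Matrix.mul_apply, Matrix.mul_apply]
    exact Equiv.sum_comp σ.symm fun l => U i l * star U l j
  · refine Matrix.ext fun i j => ?_
    rw [conjDiagonal_apply, conjDiagonal_apply]
    simp only [Matrix.submatrix_apply, id]
    refine Eq.trans ?_ (Equiv.sum_comp σ fun l => U i (σ.symm l) * q l * star (U j (σ.symm l)))
    simp

lemma unitaryOrbit_eq (k : ℕ) : unitaryOrbit t k =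
    {Q | ∃ U ∈ Matrix.unitaryGroup (Fin t) ℂ, Q = conjDiagonal U (uniformWeights t k)} := rfl

variable {Ω : Type*} [MeasurableSpace Ω] {P : Measure Ω} [IsProbabilityMeasure P]
  {H : Fin t → Ω → ℂ}

/-- The quadratic form in a frame of eigenvectors. -/
lemma quadraticForm_conjDiagonal (U : Matrix (Fin t) (Fin t) ℂ) (q : Fin t → ℝ) (h : Fin t → ℂ) :
    (∑ i, ∑ j, h i * conjDiagonal U q i j * star (h j)).re =
      ∑ l, q l * Complex.normSq (∑ i, h i * U i l) := by
  have : ∑ i, ∑ j, h i * conjDiagonal U q i j * star (h j) =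
      ((∑ l, q l * Complex.normSq (∑ i, h i * U i l) : ℝ) : ℂ) := by
    have hl : ∀ l, (q l : ℂ) * Complex.normSq (∑ i, h i * U i l) =
        ∑ i, ∑ j, h i * (U i l * q l * star (U j l)) * star (h j) := fun l => by
      rw [← Complex.mul_conj, map_sum, sum_mul_sum, mul_sum]
      refine sum_congr rfl fun i _ => ?_
      rw [mul_sum]
      refine sum_congr rfl fun j _ => ?_
      rw [map_mul]
      simp only [Complex.star_def]
      ring
    push_cast
    simp only [hl, conjDiagonal_apply, sum_mul, mul_sum]
    rw [sum_comm]
    refine (sum_congr rfl fun j _ => sum_comm).trans ?_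
    rw [sum_comm]
    exact sum_congr rfl fun l _ => sum_comm
  rw [this, Complex.ofReal_re]

lemma outageProbability_conjDiagonal (hH : ∀ i, HasLaw (H i) stdComplexGaussian P)
    (hind : iIndepFun H P) {U : Matrix (Fin t) (Fin t) ℂ}
    (hU : U ∈ Matrix.unitaryGroup (Fin t) ℂ) {q : Fin t → ℝ} (hq : ∀ i, 0 ≤ q i) {x : ℝ}
    (hx : 0 ≤ x) : outageProbability P H x (conjDiagonal U q) = smoothCdf x q := by
  obtain ⟨h1, h2⟩ := normSq_vecMul_exponential hH hind hU
  rw [← weightedSumCdf_eq h1 h2 hq hx, outageProbability, weightedSumCdf]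
  simp only [quadraticForm_conjDiagonal]

lemma argminOn_outageProbability (ht : 1 ≤ t) (hH : ∀ i, HasLaw (H i) stdComplexGaussian P)
    (hind : iIndepFun H P) {x : ℝ} (hx : 0 < x) :
    argminOn (covarianceSet t) (outageProbability P H x) =
      ⋃ k ∈ optimalSizes t x, unitaryOrbit t k := by
  have hout : ∀ {U : Matrix (Fin t) (Fin t) ℂ} {q : Fin t → ℝ},
      U ∈ Matrix.unitaryGroup (Fin t) ℂ → q ∈ weightSet t →
      outageProbability P H x (conjDiagonal U q) = smoothCdf x q := fun hU hq =>
    outageProbability_conjDiagonal hH hind hU hq.1 hx.le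
  ext Q
  simp only [Set.mem_iUnion, exists_prop, unitaryOrbit_eq]
  constructor
  · rintro ⟨hQ, hmin⟩
    obtain ⟨U, hU, q, hq, rfl⟩ := exists_eq_conjDiagonal hQ
    have hq' : q ∈ argminOn (weightSet t) (smoothCdf x) := ⟨hq, fun b hb => by
      rw [← hout hU hq, ← hout hU hb]
      exact hmin _ (conjDiagonal_mem hU hb)⟩
    rw [argminOn_smoothCdf ht hx] at hq'
    obtain ⟨k, hk, σ, rfl⟩ := Set.mem_iUnion₂.1 hq'
    exact ⟨k, hk, conjDiagonal_perm hU _ σ⟩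
  · rintro ⟨k, hk, U, hU, rfl⟩
    refine ⟨conjDiagonal_mem hU hk.2.1, fun Q hQ => ?_⟩
    obtain ⟨V, hV, q, hq, rfl⟩ := exists_eq_conjDiagonal hQ
    rw [hout hU hk.2.1, hout hV hq]
    exact hk.2.2 q hq

end Outage

theorem mainTheorem1 (t : ℕ) (ht : 1 ≤ t)
    {Ω : Type*} [MeasurableSpace Ω] (P : Measure Ω) [IsProbabilityMeasure P]
    (X : Fin t → Ω → ℝ) (hXlaw : ∀ i, HasLaw (X i) (expMeasure 1) P) (hXind : iIndepFun X P)
    {Ω' : Type*} [MeasurableSpace Ω'] (P' : Measure Ω') [IsProbabilityMeasure P']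
    (H : Fin t → Ω' → ℂ) (hHlaw : ∀ i, HasLaw (H i) stdComplexGaussian P')
    (hHind : iIndepFun H P') :
    (∀ x : ℝ, 0 < x → ∃ K : Set ℕ, K.Nonempty ∧ K ⊆ Set.Icc 1 t ∧
      argminOn (weightSet t) (weightedSumCdf P X x) = ⋃ k ∈ K, permutationOrbit t k ∧
      argminOn (covarianceSet t) (outageProbability P' H x) = ⋃ k ∈ K, unitaryOrbit t k) ∧
    ∃ E : Set ℝ, E.Finite ∧ ∀ x : ℝ, 0 < x → x ∉ E → ∃ k ∈ Set.Icc 1 t,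
      argminOn (weightSet t) (weightedSumCdf P X x) = permutationOrbit t k ∧
      argminOn (covarianceSet t) (outageProbability P' H x) = unitaryOrbit t k := by
  have hA : ∀ x : ℝ, 0 < x → argminOn (weightSet t) (weightedSumCdf P X x) =
      ⋃ k ∈ optimalSizes t x, permutationOrbit t k := fun x hx => by
    rw [argminOn_weightedSumCdf hXlaw hXind hx, argminOn_smoothCdf ht hx]
  have hB : ∀ x : ℝ, 0 < x → argminOn (covarianceSet t) (outageProbability P' H x) =
      ⋃ k ∈ optimalSizes t x, unitaryOrbit t k := fun x hx =>
    argminOn_outageProbability ht hHlaw hHind hx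
  refine ⟨fun x hx => ⟨optimalSizes t x, optimalSizes_nonempty ht hXlaw hXind hx,
    fun k hk => hk.1, hA x hx, hB x hx⟩, coincidences t, finite_coincidences t,
    fun x hx hE => ?_⟩
  obtain ⟨k, hk, hK⟩ := optimalSizes_eq_singleton hx hE (optimalSizes_nonempty ht hXlaw hXind hx)
  refine ⟨k, hk, ?_, ?_⟩
  · rw [hA x hx, hK, Set.biUnion_singleton]
  · rw [hB x hx, hK, Set.biUnion_singleton]
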